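/- Let $d\ge 1$, let $G_F$ be a nonempty finite simple graph with adjacency matrix $\mathcal A_{G_F}$, let $Q:G_F\to\mathbb R$ be a potential, and put $H_{G_F}=\mathcal A_{G_F}+Q$. Let $\Gamma=\mathbb Z^d\mathop\square G_F$ be the Cartesian product with the nearest-neighbour graph $\mathbb Z^d$, write its vertices as $n+v$ with $n\in\mathbb Z^d$, $v\in G_F$, and let $H=\mathcal A_\Gamma+Q$ on $\ell^2(\Gamma)$, where $\mathcal A_\Gamma$ is the adjacency operator of $\Gamma$ and $Q$ is copied across the layers, $Q(n+v)=Q(v)$. For an operator $T$ on $\ell^2(\Gamma)$ write $T(x,y)=(T\delta_y)(x)$. Then: (i) For all $t\in\mathbb R$, $n,m\in\mathbb Z^d$ and $v_p,v_q\in G_F$, $$e^{itH}(n+v_p,m+v_q)=\Big(\prod_{j=1}^d i^{\,n_j-m_j}J_{n_j-m_j}(2t)\Big)\,e^{itH_{G_F}}(v_p,v_q),$$ where $J_k$ is the Bessel function of the first kind of integer order $k$. (ii) For all $t>0$ and all $f\in\ell^1(\Gamma)$ with $f\ne 0$, $$\|e^{itH}f\|_\infty<\frac{1}{t^{d/3}}\,\|f\|_1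 .$$ (iii) The decay rate $t^{-d/3}$ in (ii) is sharp: there is a constant $c>0$ (which may depend on $d$, $G_F$ and $Q$) such that for every $t\ge 1$ there is a nonzero $f\in\ell^1(\Gamma)$ with $$\|e^{itH}f\|_\infty\ge \frac{c}{t^{d/3}}\,\|f\|_1 .$$ -/

import Mathlib

open scoped ENNReal BigOperators

noncomputable section

/-! ### Bessel functions of the first kind of integer order -/

/-- `J_k(x) = ∑_{m ≥ 0} (-1)^m / (m! (m+k)!) (x/2)^(2m+k)` for an integer `k ≥ 0`. -/
def besselJNat (k : ℕ) (x : ℝ) : ℝ :=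
  ∑' m : ℕ, (-1 : ℝ) ^ m / ((m.factorial : ℝ) * ((m + k).factorial : ℝ)) * (x / 2) ^ (2 * m + k)

/-- The Bessel function `J_k` of integer order `k`, with `J_{-k} = (-1)^k J_k`. -/
def besselJ : ℤ → ℝ → ℝ
  | Int.ofNat k, x => besselJNat k x
  | Int.negSucc k, x => (-1 : ℝ) ^ (k + 1) * besselJNat (k + 1) x

/-- The power series defining `besselJNat` converges everywhere. -/
theorem summable_besselJNat (k : ℕ) (x : ℝ) :
    Summable (fun m : ℕ => (-1 : ℝ) ^ m / ((m.factorial : ℝ) * ((m + k).factorial : ℝ)) *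
      (x / 2) ^ (2 * m + k)) := by
  refine Summable.of_norm_bounded
    (g := fun m : ℕ => |x / 2| ^ k * (((x / 2) ^ 2) ^ m / (m.factorial : ℝ)))
    ((Real.summable_pow_div_factorial _).mul_left _) (fun m => ?_)
  have h1 : (1 : ℝ) ≤ ((m + k).factorial : ℝ) := by
    exact_mod_cast Nat.succ_le_of_lt (Nat.factorial_pos _)
  have h2 : (0 : ℝ) < (m.factorial : ℝ) := by exact_mod_cast Nat.factorial_pos _
  have h3 : |x / 2| ^ (2 * m + k) = |x / 2| ^ k * ((x / 2) ^ 2) ^ m := by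
    rw [pow_add, pow_mul, sq_abs, mul_comm]
  rw [Real.norm_eq_abs, abs_mul, abs_div, abs_pow, abs_pow, abs_neg, abs_one, one_pow, h3, abs_mul,
    abs_of_pos h2, abs_of_pos (lt_of_lt_of_le one_pos h1), div_mul_eq_mul_div, one_mul, mul_div_assoc]
  gcongr
  nlinarith

/-! ### Schrödinger operators on graphs of bounded degree -/

/-- `(𝒜 f + Q f)(x) = ∑_{y ∼ x} f(y) + Q(x) f(x)`. -/
def schrodingerFun {X : Type*} (G : SimpleGraph X) [G.LocallyFinite] (Q : X → ℝ)
    (f : X → ℂ) (x : X) : ℂ :=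
  (∑ y ∈ G.neighborFinset x, f y) + (Q x : ℂ) * f x

/-- Schur's bound for the adjacency operator on a graph with degrees at most `D`. -/
theorem adjacency_sum_sq_le {X : Type*} (G : SimpleGraph X) [G.LocallyFinite] {D : ℕ}
    (hD : ∀ x, G.degree x ≤ D) (f : lp (fun _ : X => ℂ) 2) (s : Finset X) :
    ∑ x ∈ s, ‖∑ y ∈ G.neighborFinset x, f y‖ ^ (2 : ℝ≥0∞).toReal
      ≤ ((D : ℝ) * ‖f‖) ^ (2 : ℝ≥0∞).toReal := by
  classical
  have key : ∀ t : Finset X, ∑ y ∈ t, ‖f y‖ ^ 2 ≤ ‖f‖ ^ 2 := by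
    intro t
    have := lp.sum_rpow_le_norm_rpow (p := 2) (by norm_num) f t
    simpa using this
  have e : (2 : ℝ≥0∞).toReal = ((2 : ℕ) : ℝ) := by norm_num
  simp only [e, Real.rpow_natCast]
  have hx : ∀ x ∈ s, ‖∑ y ∈ G.neighborFinset x, f y‖ ^ 2
      ≤ (D : ℝ) * ∑ y ∈ G.neighborFinset x, ‖f y‖ ^ 2 := by
    intro x _
    calc ‖∑ y ∈ G.neighborFinset x, f y‖ ^ 2
        ≤ (∑ y ∈ G.neighborFinset x, ‖f y‖) ^ 2 := by
          gcongr
          exact norm_sum_le _ _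
      _ ≤ (G.neighborFinset x).card * ∑ y ∈ G.neighborFinset x, ‖f y‖ ^ 2 :=
          sq_sum_le_card_mul_sum_sq
      _ ≤ (D : ℝ) * ∑ y ∈ G.neighborFinset x, ‖f y‖ ^ 2 := by
          gcongr
          exact hD x
  refine (Finset.sum_le_sum hx).trans ?_
  rw [← Finset.mul_sum]
  set t := s.biUnion (fun x => G.neighborFinset x) with ht
  have swap : ∑ x ∈ s, ∑ y ∈ G.neighborFinset x, ‖f y‖ ^ 2
      = ∑ y ∈ t, ∑ x ∈ s.filter (fun x => G.Adj x y), ‖f y‖ ^ 2 := by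
    refine Finset.sum_comm' (fun x y => ?_)
    simp only [ht, SimpleGraph.mem_neighborFinset, Finset.mem_filter, Finset.mem_biUnion]
    constructor
    · rintro ⟨h1, h2⟩
      exact ⟨⟨h1, h2⟩, x, h1, h2⟩
    · rintro ⟨h, _⟩
      exact h
  have hcard : ∀ y, ((s.filter (fun x => G.Adj x y)).card : ℝ) ≤ D := by
    intro y
    have h1 : (s.filter (fun x => G.Adj x y)) ⊆ G.neighborFinset y := by
      intro x hx
      rw [SimpleGraph.mem_neighborFinset]
      exact (Finset.mem_filter.1 hx).2.symm
    exact_mod_cast (Finset.card_le_card h1).trans (hD y)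
  have h4 : ∑ x ∈ s, ∑ y ∈ G.neighborFinset x, ‖f y‖ ^ 2 ≤ (D : ℝ) * ‖f‖ ^ 2 := by
    rw [swap]
    calc ∑ y ∈ t, ∑ x ∈ s.filter (fun x => G.Adj x y), ‖f y‖ ^ 2
        ≤ ∑ y ∈ t, (D : ℝ) * ‖f y‖ ^ 2 := by
          refine Finset.sum_le_sum (fun y _ => ?_)
          rw [Finset.sum_const, nsmul_eq_mul]
          gcongr
          exact mod_cast hcard y
      _ ≤ (D : ℝ) * ‖f‖ ^ 2 := by
          rw [← Finset.mul_sum]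
          gcongr
          exact key t
  calc (D : ℝ) * ∑ x ∈ s, ∑ y ∈ G.neighborFinset x, ‖f y‖ ^ 2
      ≤ (D : ℝ) * ((D : ℝ) * ‖f‖ ^ 2) := by gcongr
    _ = ((D : ℝ) * ‖f‖) ^ 2 := by ring

theorem adjacency_memℓp {X : Type*} (G : SimpleGraph X) [G.LocallyFinite] {D : ℕ}
    (hD : ∀ x, G.degree x ≤ D) (f : lp (fun _ : X => ℂ) 2) :
    Memℓp (fun x => ∑ y ∈ G.neighborFinset x, f y) 2 :=
  memℓp_gen' (adjacency_sum_sq_le G hD f)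

theorem potential_memℓp {X : Type*} {Q : X → ℝ} {C : ℝ} (hQ : ∀ x, |Q x| ≤ C)
    (f : lp (fun _ : X => ℂ) 2) : Memℓp (fun x => (Q x : ℂ) * f x) 2 := by
  refine Memℓp.mono (g := fun x => C * ‖f x‖) (((lp.memℓp f).norm).const_mul C) (fun x => ?_)
  rw [norm_mul, Complex.norm_real]
  exact mul_le_mul_of_nonneg_right (hQ x) (norm_nonneg _)

theorem schrodingerFun_memℓp {X : Type*} (G : SimpleGraph X) [G.LocallyFinite] {D : ℕ}
    (hD : ∀ x, G.degree x ≤ D) {Q : X → ℝ} {C : ℝ} (hQ : ∀ x, |Q x| ≤ C)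
    (f : lp (fun _ : X => ℂ) 2) : Memℓp (schrodingerFun G Q f) 2 :=
  (adjacency_memℓp G hD f).add (potential_memℓp hQ f)

theorem schrodingerFun_norm_le {X : Type*} (G : SimpleGraph X) [G.LocallyFinite] {D : ℕ}
    (hD : ∀ x, G.degree x ≤ D) {Q : X → ℝ} {C : ℝ} (hQ : ∀ x, |Q x| ≤ C)
    (f : lp (fun _ : X => ℂ) 2) :
    ‖(⟨schrodingerFun G Q f, schrodingerFun_memℓp G hD hQ f⟩ : lp (fun _ : X => ℂ) 2)‖
      ≤ ((D : ℝ) + |C|) * ‖f‖ := by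
  have hsplit : (⟨schrodingerFun G Q f, schrodingerFun_memℓp G hD hQ f⟩ : lp (fun _ : X => ℂ) 2)
      = (⟨_, adjacency_memℓp G hD f⟩ : lp (fun _ : X => ℂ) 2)
        + (⟨_, potential_memℓp hQ f⟩ : lp (fun _ : X => ℂ) 2) := rfl
  rw [hsplit, add_mul]
  refine (norm_add_le _ _).trans (add_le_add ?_ ?_)
  · exact lp.norm_le_of_forall_sum_le (by norm_num) (by positivity) (adjacency_sum_sq_le G hD f)
  · refine lp.norm_le_of_forall_sum_le (by norm_num) (by positivity) (fun s => ?_)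
    have key : ∑ y ∈ s, ‖f y‖ ^ 2 ≤ ‖f‖ ^ 2 := by
      have := lp.sum_rpow_le_norm_rpow (p := 2) (by norm_num) f s
      simpa using this
    have e : (2 : ℝ≥0∞).toReal = ((2 : ℕ) : ℝ) := by norm_num
    simp only [e, Real.rpow_natCast]
    calc ∑ x ∈ s, ‖(Q x : ℂ) * f x‖ ^ 2 ≤ ∑ x ∈ s, |C| ^ 2 * ‖f x‖ ^ 2 := by
          refine Finset.sum_le_sum (fun x _ => ?_)
          rw [norm_mul, Complex.norm_real, mul_pow, Real.norm_eq_abs]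
          exact mul_le_mul_of_nonneg_right
            (pow_le_pow_left₀ (abs_nonneg _) ((hQ x).trans (le_abs_self C)) 2) (sq_nonneg _)
      _ ≤ |C| ^ 2 * ‖f‖ ^ 2 := by
          rw [← Finset.mul_sum]
          gcongr
      _ = (|C| * ‖f‖) ^ 2 := by ring

/-- The Schrödinger operator `𝒜 + Q` on `ℓ²(X)`, for a graph on `X` with degrees at most `D` and
a real potential bounded by `C`. -/
def schrodingerOp {X : Type*} (G : SimpleGraph X) [G.LocallyFinite] {D : ℕ}
    (hD : ∀ x, G.degree x ≤ D) (Q : X → ℝ) {C : ℝ} (hQ : ∀ x, |Q x| ≤ C) :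
    lp (fun _ : X => ℂ) 2 →L[ℂ] lp (fun _ : X => ℂ) 2 :=
  LinearMap.mkContinuous
    { toFun := fun f => ⟨schrodingerFun G Q f, schrodingerFun_memℓp G hD hQ f⟩
      map_add' := by
        intro f g
        ext x
        simp only [schrodingerFun, lp.coeFn_add, Pi.add_apply, Finset.sum_add_distrib]
        ring
      map_smul' := by
        intro c f
        ext x
        simp only [schrodingerFun, lp.coeFn_smul, Pi.smul_apply, smul_eq_mul, RingHom.id_apply,
          ← Finset.mul_sum]
        ring }
    ((D : ℝ) + |C|) (schrodingerFun_norm_le G hD hQ)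

theorem schrodingerOp_apply {X : Type*} (G : SimpleGraph X) [G.LocallyFinite] {D : ℕ}
    (hD : ∀ x, G.degree x ≤ D) (Q : X → ℝ) {C : ℝ} (hQ : ∀ x, |Q x| ≤ C)
    (f : lp (fun _ : X => ℂ) 2) (x : X) :
    schrodingerOp G hD Q hQ f x = (∑ y ∈ G.neighborFinset x, f y) + (Q x : ℂ) * f x := rfl

/-! ### The lattice `ℤ^d` and the product `ℤ^d □ G_F` -/

/-- The nearest neighbour graph on `ℤ^d`: the neighbours of `n` are `n ± e_j`. -/
def latticeGraph (d : ℕ) : SimpleGraph (Fin d → ℤ) where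
  Adj n m := ∃ j : Fin d, m = n + Pi.single j 1 ∨ m = n - Pi.single j 1
  symm := ⟨by
    rintro n m ⟨j, h | h⟩
    · exact ⟨j, Or.inr (by rw [h, add_sub_cancel_right])⟩
    · exact ⟨j, Or.inl (by rw [h, sub_add_cancel])⟩⟩
  loopless := ⟨by
    rintro n ⟨j, h | h⟩
    · have := congrFun h j
      simp at this
    · have := congrFun h j
      simp only [Pi.sub_apply, Pi.single_eq_same] at this
      omega⟩

/-- The finitely many neighbours `n ± e_j` of `n`. -/
def latticeNeighbors (d : ℕ) (n : Fin d → ℤ) : Finset (Fin d → ℤ) :=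
  (Finset.univ : Finset (Fin d)).image (fun j => n + Pi.single j 1) ∪
    (Finset.univ : Finset (Fin d)).image (fun j => n - Pi.single j 1)

theorem mem_latticeNeighbors (d : ℕ) (n m : Fin d → ℤ) :
    m ∈ latticeNeighbors d n ↔ m ∈ (latticeGraph d).neighborSet n := by
  simp only [latticeNeighbors, Finset.mem_union, Finset.mem_image, Finset.mem_univ, true_and,
    SimpleGraph.mem_neighborSet, latticeGraph, exists_or, eq_comm]

instance latticeGraph_locallyFinite (d : ℕ) : (latticeGraph d).LocallyFinite :=
  fun n => Fintype.ofFinset (latticeNeighbors d n) (mem_latticeNeighbors d n)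

theorem latticeGraph_degree_le (d : ℕ) (n : Fin d → ℤ) : (latticeGraph d).degree n ≤ d + d := by
  have h : (latticeGraph d).neighborFinset n = latticeNeighbors d n := by
    ext m
    rw [SimpleGraph.mem_neighborFinset, mem_latticeNeighbors, SimpleGraph.mem_neighborSet]
  rw [← SimpleGraph.card_neighborFinset_eq_degree, h]
  refine (Finset.card_union_le _ _).trans (add_le_add ?_ ?_)
  · exact Finset.card_image_le.trans (by simp)
  · exact Finset.card_image_le.trans (by simp)

instance boxProd_locallyFinite (d : ℕ) {V : Type*} [Fintype V] (G : SimpleGraph V)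
    [DecidableRel G.Adj] : (latticeGraph d □ G).LocallyFinite :=
  fun x => SimpleGraph.boxProdFintypeNeighborSet x

theorem boxProd_degree_le (d : ℕ) {V : Type*} [Fintype V] (G : SimpleGraph V)
    [DecidableRel G.Adj] (x : (Fin d → ℤ) × V) :
    (latticeGraph d □ G).degree x ≤ (d + d) + Fintype.card V := by
  rw [SimpleGraph.degree_boxProd]
  refine add_le_add (latticeGraph_degree_le d x.1) ?_
  rw [← SimpleGraph.card_neighborFinset_eq_degree]
  exact Finset.card_le_univ _

theorem abs_potential_le {V : Type*} [Fintype V] (Q : V → ℝ) (v : V) : |Q v| ≤ ∑ w, |Q w| :=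
  Finset.single_le_sum (f := fun w => |Q w|) (fun _ _ => abs_nonneg _) (Finset.mem_univ v)

/-- The Schrödinger operator `H = 𝒜 + Q` on `ℓ²(ℤ^d □ G)`, where the potential `Q` on the finite
graph `G` is copied across the layers: `Q(n + v) = Q(v)`. The vertex `n + v` is the pair
`(n, v)`. -/
def productHamiltonian (d : ℕ) {V : Type*} [Fintype V] (G : SimpleGraph V) [DecidableRel G.Adj]
    (Q : V → ℝ) :
    lp (fun _ : (Fin d → ℤ) × V => ℂ) 2 →L[ℂ] lp (fun _ : (Fin d → ℤ) × V => ℂ) 2 :=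
  schrodingerOp (latticeGraph d □ G) (boxProd_degree_le d G) (fun x => Q x.2)
    (fun x => abs_potential_le Q x.2)

/-- The Schrödinger matrix `H_G = 𝒜_G + Q` of the finite graph `G`. -/
def finiteHamiltonian {V : Type*} [Fintype V] [DecidableEq V] (G : SimpleGraph V)
    [DecidableRel G.Adj] (Q : V → ℝ) : Matrix V V ℂ :=
  G.adjMatrix ℂ + Matrix.diagonal (fun v => (Q v : ℂ))

/-- `e^{itH}` on `ℓ²(X)` for a bounded operator `H`. -/
def propagator {X : Type*} (H : lp (fun _ : X => ℂ) 2 →L[ℂ] lp (fun _ : X => ℂ) 2) (t : ℝ) :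
    lp (fun _ : X => ℂ) 2 →L[ℂ] lp (fun _ : X => ℂ) 2 :=
  NormedSpace.exp ((Complex.I * (t : ℂ)) • H)

/-- The kernel `T(x, y) = (T δ_y)(x)` of an operator `T` on `ℓ²(X)`. -/
def kernel {X : Type*} [DecidableEq X]
    (T : lp (fun _ : X => ℂ) 2 →L[ℂ] lp (fun _ : X => ℂ) 2) (x y : X) : ℂ :=
  T (lp.single 2 y (1 : ℂ)) x

/-- The inclusion `ℓ¹(X) ⊆ ℓ²(X)`. -/
def l1ToL2 {X : Type*} (f : lp (fun _ : X => ℂ) 1) : lp (fun _ : X => ℂ) 2 :=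
  ⟨f, (lp.memℓp f).of_exponent_ge one_le_two⟩

/-- The inclusion `ℓ²(X) ⊆ ℓ^∞(X)`. -/
def l2ToLinfty {X : Type*} (f : lp (fun _ : X => ℂ) 2) : lp (fun _ : X => ℂ) ∞ :=
  ⟨f, (lp.memℓp f).of_exponent_ge le_top⟩

end

/-!
The Hamiltonian of `ℤ^d □ G` is a sum of commuting operators: for each direction `j` the two
translations `S_j + S_j⁻¹`, and the operator `layerOp` acting inside the layers. Hence `e^{itH}` is
a product of exponentials. The layer factor acts on a point mass as the matrix `e^{itH_G}`
(`exp_layerOp_single`), and expanding `exp (it S) exp (it S⁻¹)` as a double power series gives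
`i^k J_k(2t)` as the coefficient of `S^k` (`map_exp_mul_exp`). The same coefficient extraction, in
the Banach algebra of continuous functions on the circle, gives Bessel's integral
`J_k(x) = (2π)⁻¹ ∫ e^{i(x sin θ - kθ)} dθ` (`besselJ_eq_integral`).

Since `e^{itH_G}` is unitary, everything else reduces to the size of `sup_k |J_k(2t)|`, which is of
order `t^{-1/3}`.

*Upper bound* (`exists_besselJ_bound`). The constant matters, as `sup_k |J_k(2t)| < t^{-1/3}` is
needed for every `t > 0`. For `t < 1` the trivial bound `|J_k| ≤ 1` suffices, and for `1 ≤ t ≤ 2.79`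
the bound `J_k² ≤ 1/2`, from Bessel's inequality and the three-term recurrence, does. For larger
`t` let `x = 2t` and let
`p = x cos θ - k` be the derivative of the phase. Integrating by parts against `p / (p² + μ²)`
instead of `1 / p` leaves no boundary terms on the circle, and bounds `2π |J_k|` by the
integral of the Lorentzian `μ² / (μ² + p²)`, evaluated by Cauchy's formula, plus the total variation
of the multiplier, at most `4 / μ`. Both are of order `t^{-1/3}` when `μ` is a multiple of
`t^{1/3}`.

*Lower bound* (`exists_besselJ_ge`). Multiplying the integrand of order `k ≈ x` by
`cos²(θ/2) ^ M` replaces `J_k` by an average of `J_l` over neighbouring orders `l` with binomial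
weights, so the integral is at most `2π sup_l |J_l(x)|`. With `M ≈ t^{2/3}` the bump lives on
`|θ| ≲ t^{-1/3}`, where the phase `x sin θ - kθ` is small, so the integral is comparable to the mass
`π / √M` of the bump.
-/

noncomputable section

/-! ### Extracting Bessel functions from a product of exponentials -/

/-- The case of nonnegative order in `map_exp_mul_exp`; no commutation is needed. -/
theorem map_exp_mul_exp_natCast {𝔸 : Type*} [NormedRing 𝔸] [NormedAlgebra ℂ 𝔸] [CompleteSpace 𝔸]
    (ℓ : 𝔸 →L[ℂ] ℂ) (u v : 𝔸) (k : ℕ) (c : ℂ)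
    (h : ∀ a b : ℕ, ℓ (u ^ a * v ^ b) = if a = b + k then c else 0) (t : ℝ) :
    ℓ (NormedSpace.exp ((Complex.I * t) • u) * NormedSpace.exp ((Complex.I * t) • v)) =
      c * (Complex.I ^ k * (besselJNat k (2 * t) : ℂ)) := by
  set z : ℂ := Complex.I * t with hz
  have hexp : ∀ w : 𝔸, HasSum (fun n : ℕ => ((n.factorial : ℂ)⁻¹ * z ^ n) • w ^ n)
      (NormedSpace.exp (z • w)) := by
    intro w
    have := NormedSpace.exp_series_hasSum_exp' (𝕂 := ℂ) (z • w)
    simpa only [smul_pow, smul_smul] using this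
  have inner : ∀ b : ℕ, ℓ (NormedSpace.exp (z • u) * v ^ b) =
      (((b + k).factorial : ℂ)⁻¹ * z ^ (b + k)) * c := by
    intro b
    have h1 := ((hexp u).mul_right (v ^ b)).mapL ℓ
    have hterm : (fun a : ℕ => ℓ (((a.factorial : ℂ)⁻¹ * z ^ a) • u ^ a * v ^ b)) =
        fun a => if a = b + k then (((b + k).factorial : ℂ)⁻¹ * z ^ (b + k)) * c else 0 := by
      funext a
      rw [smul_mul_assoc, map_smul, h]
      split_ifs with hab
      · rw [hab, smul_eq_mul]
      · rw [smul_zero]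
    rw [hterm] at h1
    exact h1.unique (hasSum_ite_eq _ _)
  have outer := ((hexp v).mul_left (NormedSpace.exp (z • u))).mapL ℓ
  have hJ := (((Complex.hasSum_ofReal.2 (summable_besselJNat k (2 * t)).hasSum)).mul_left
    (Complex.I ^ k)).mul_left c
  have hterm : (fun b : ℕ => ℓ (NormedSpace.exp (z • u) * ((b.factorial : ℂ)⁻¹ * z ^ b) • v ^ b)) =
      fun b => c * (Complex.I ^ k * (((-1 : ℝ) ^ b / ((b.factorial : ℝ) * ((b + k).factorial : ℝ)) *
        (2 * t / 2) ^ (2 * b + k) : ℝ) : ℂ)) := by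
    funext b
    have e : (2 * t / 2 : ℝ) = t := by ring
    have hI : (-1 : ℂ) ^ b = Complex.I ^ b * Complex.I ^ b := by
      rw [← mul_pow, Complex.I_mul_I]
    rw [mul_smul_comm, map_smul, inner, smul_eq_mul, hz, e]
    push_cast
    rw [hI, mul_pow, mul_pow, two_mul, pow_add Complex.I b k, pow_add (t : ℂ) b k,
      pow_add (t : ℂ) (b + b) k, pow_add (t : ℂ) b b, div_eq_mul_inv, mul_inv]
    ring
  rw [hterm] at outer
  exact outer.unique hJ

/-- The coefficient extraction behind both the kernel formula and Bessel's integral: if `ℓ` reads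
off the coefficient of `w ^ k` from Laurent monomials `w ^ a * w⁻¹ ^ b`, then it maps the generating
function `exp (it (w + w⁻¹))` to a multiple of `i ^ k J_k(2t)`. -/
theorem map_exp_mul_exp {𝔸 : Type*} [NormedRing 𝔸] [NormedAlgebra ℂ 𝔸] [CompleteSpace 𝔸]
    (ℓ : 𝔸 →L[ℂ] ℂ) {u v : 𝔸} (huv : Commute u v) (k : ℤ) (c : ℂ)
    (h : ∀ a b : ℕ, ℓ (u ^ a * v ^ b) = if (a : ℤ) - b = k then c else 0) (t : ℝ) :
    ℓ (NormedSpace.exp ((Complex.I * t) • u) * NormedSpace.exp ((Complex.I * t) • v)) =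
      c * (Complex.I ^ k * (besselJ k (2 * t) : ℂ)) := by
  obtain k | k := k
  · refine (map_exp_mul_exp_natCast ℓ u v k c (fun a b => ?_) t).trans ?_
    · rw [h]
      congr 1
      simp only [Int.ofNat_eq_natCast, eq_iff_iff]
      omega
    · simp only [besselJ, Int.ofNat_eq_natCast, zpow_natCast]
  · have hc : Commute (NormedSpace.exp ((Complex.I * t) • u))
        (NormedSpace.exp ((Complex.I * t) • v)) :=
      Commute.exp ((huv.smul_left _).smul_right _)
    rw [hc.eq]
    refine (map_exp_mul_exp_natCast ℓ v u (k + 1) c (fun a b => ?_) t).trans ?_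
    · rw [((huv.pow_left b).pow_right a).eq.symm, h]
      congr 1
      simp only [eq_iff_iff]
      omega
    · have hI : Complex.I ^ (k + 1) = Complex.I ^ Int.negSucc k * (-1) ^ (k + 1) := by
        rw [zpow_negSucc, ← Complex.I_mul_I, mul_pow, ← mul_assoc,
          inv_mul_cancel₀ (pow_ne_zero _ Complex.I_ne_zero), one_mul]
      simp only [besselJ, hI]
      push_cast
      ring

/-! ### Translations of `ℓ²` and the layer decomposition of the Hamiltonian -/

/-- The operator `f ↦ f ∘ e` on `ℓ²(X)` induced by a permutation `e` of `X`. -/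
def permOp {X : Type*} (e : Equiv.Perm X) :
    lp (fun _ : X => ℂ) 2 →L[ℂ] lp (fun _ : X => ℂ) 2 :=
  LinearMap.mkContinuous
    { toFun := fun f => ⟨fun x => f (e x), by
        have := lp.memℓp f
        rw [memℓp_gen_iff (by norm_num)] at this
        refine (memℓp_gen_iff (by norm_num)).2 ?_
        exact (e.summable_iff (f := fun x => ‖f x‖ ^ (2 : ℝ≥0∞).toReal)).2 this⟩
      map_add' := fun f g => by ext x; rfl
      map_smul' := fun c f => by ext x; rfl }
    1 (fun f => by
      rw [one_mul]
      refine le_of_eq ?_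
      rw [lp.norm_eq_tsum_rpow (by norm_num), lp.norm_eq_tsum_rpow (by norm_num)]
      exact congrArg (· ^ (1 / (2 : ℝ≥0∞).toReal))
        (e.tsum_eq (fun x => ‖f x‖ ^ (2 : ℝ≥0∞).toReal)))

theorem clm_mul_apply {X : Type*} (A B : lp (fun _ : X => ℂ) 2 →L[ℂ] lp (fun _ : X => ℂ) 2)
    (f : lp (fun _ : X => ℂ) 2) : (A * B) f = A (B f) := rfl

theorem exp_smul_add_of_commute {𝔸 : Type*} [NormedRing 𝔸] [NormedAlgebra ℂ 𝔸] [CompleteSpace 𝔸]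
    (z : ℂ) {A B : 𝔸} (h : Commute A B) :
    NormedSpace.exp (z • (A + B)) = NormedSpace.exp (z • A) * NormedSpace.exp (z • B) := by
  let : NormedAlgebra ℚ 𝔸 := NormedAlgebra.restrictScalars ℚ ℂ 𝔸
  rw [smul_add, NormedSpace.exp_add_of_commute ((h.smul_left z).smul_right z)]

section Layers

variable {d : ℕ} {V : Type*}

/-- Translation by `g ∈ ℤ^d` along the layers: `(S_g f)(n + v) = f((n - g) + v)`. -/
def layerShift (V : Type*) (g : Fin d → ℤ) :
    lp (fun _ : (Fin d → ℤ) × V => ℂ) 2 →L[ℂ] lp (fun _ : (Fin d → ℤ) × V => ℂ) 2 :=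
  permOp ((Equiv.subRight g).prodCongr (Equiv.refl V))

theorem layerShift_apply (g : Fin d → ℤ) (f : lp (fun _ : (Fin d → ℤ) × V => ℂ) 2)
    (n : Fin d → ℤ) (v : V) : layerShift V g f (n, v) = f (n - g, v) := rfl

theorem layerShift_commute (g h : Fin d → ℤ) : Commute (layerShift V g) (layerShift V h) := by
  refine ContinuousLinearMap.ext fun f => lp.ext (funext fun ⟨n, v⟩ => ?_)
  rw [clm_mul_apply, clm_mul_apply]
  simp only [layerShift_apply]
  rw [sub_right_comm]

theorem layerShift_pow_apply (g : Fin d → ℤ) (a : ℕ) (f : lp (fun _ : (Fin d → ℤ) × V => ℂ) 2)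
    (n : Fin d → ℤ) (v : V) : (layerShift V g ^ a) f (n, v) = f (n - a • g, v) := by
  induction a generalizing n with
  | zero => simp
  | succ a ih =>
    rw [pow_succ', clm_mul_apply, layerShift_apply, ih]
    rw [sub_sub, succ_nsmul']

/-- The part of the adjacency operator that comes from the edges in the directions of `s`. -/
def directionOp (V : Type*) (s : Finset (Fin d)) :
    lp (fun _ : (Fin d → ℤ) × V => ℂ) 2 →L[ℂ] lp (fun _ : (Fin d → ℤ) × V => ℂ) 2 :=
  ∑ j ∈ s, (layerShift V (Pi.single j 1) + layerShift V (-Pi.single j 1))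

theorem directionOp_commute_shift (s : Finset (Fin d)) (g : Fin d → ℤ) :
    Commute (layerShift V g) (directionOp V s) :=
  Commute.sum_right _ _ _ fun _ _ =>
    (layerShift_commute _ _).add_right (layerShift_commute _ _)

theorem lp_sum_apply {X ι : Type*} (s : Finset ι) (f : ι → lp (fun _ : X => ℂ) 2) (x : X) :
    (∑ i ∈ s, f i) x = ∑ i ∈ s, f i x := by
  rw [lp.coeFn_sum, Finset.sum_apply]

theorem directionOp_apply (s : Finset (Fin d)) (f : lp (fun _ : (Fin d → ℤ) × V => ℂ) 2)
    (n : Fin d → ℤ) (v : V) : directionOp V s f (n, v) =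
      ∑ j ∈ s, (f (n - Pi.single j 1, v) + f (n + Pi.single j 1, v)) := by
  simp only [directionOp, sum_apply]
  rw [lp_sum_apply]
  refine Finset.sum_congr rfl fun j _ => ?_
  rw [add_apply, lp.coeFn_add, Pi.add_apply, layerShift_apply,
    layerShift_apply, sub_neg_eq_add]

/-- Propagation in the direction `j` of a function carried by the hyperplane `n j = a`. -/
theorem exp_shift_apply (j : Fin d) (a : ℤ) (t : ℝ) (f : lp (fun _ : (Fin d → ℤ) × V => ℂ) 2)
    (hf : ∀ n v, n j ≠ a → f (n, v) = 0) (n : Fin d → ℤ) (v : V) :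
    NormedSpace.exp ((Complex.I * t) •
        (layerShift V (Pi.single j 1) + layerShift V (-Pi.single j 1))) f (n, v) =
      Complex.I ^ (n j - a) * (besselJ (n j - a) (2 * t) : ℂ) * f (Function.update n j a, v) := by
  have hc : Commute (layerShift V (Pi.single j 1)) (layerShift V (-Pi.single j (1 : ℤ))) :=
    layerShift_commute _ _
  rw [exp_smul_add_of_commute _ hc]
  have key := map_exp_mul_exp
    ((lp.evalCLM ℂ (fun _ : (Fin d → ℤ) × V => ℂ) 2 (n, v)).comp
      (ContinuousLinearMap.apply ℂ (lp (fun _ : (Fin d → ℤ) × V => ℂ) 2) f))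
    hc (n j - a) (f (Function.update n j a, v)) (fun b c => ?_) t
  · exact key.trans (mul_comm _ _)
  · change (layerShift V (Pi.single j 1) ^ b * layerShift V (-Pi.single j 1) ^ c) f (n, v) = _
    rw [clm_mul_apply, layerShift_pow_apply, layerShift_pow_apply]
    split_ifs with h
    · refine congrArg (fun y => f (y, v)) (funext fun i => ?_)
      by_cases hi : i = j
      · subst hi
        simp
        omega
      · simp [hi]
    · refine hf _ _ fun h' => h ?_
      simp at h'
      omega

/-- Propagation of a function carried by the layer `m`, in the directions of `s` only. -/
theorem exp_directionOp_apply (s : Finset (Fin d)) (m : Fin d → ℤ) (t : ℝ)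
    (f : lp (fun _ : (Fin d → ℤ) × V => ℂ) 2)
    (hf : ∀ n v, n ≠ m → f (n, v) = 0) (n : Fin d → ℤ) (v : V) :
    NormedSpace.exp ((Complex.I * t) • directionOp V s) f (n, v) =
      (∏ j, if j ∈ s then Complex.I ^ (n j - m j) * (besselJ (n j - m j) (2 * t) : ℂ)
        else if n j = m j then 1 else 0) * f (m, v) := by
  induction s using Finset.induction_on generalizing n v with
  | empty =>
    simp only [directionOp, Finset.sum_empty, smul_zero, NormedSpace.exp_zero,
      Finset.notMem_empty, if_false, one_apply_eq_self]
    by_cases h : n = m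
    · subst h; simp
    · rw [hf n v h]
      obtain ⟨j, hj⟩ := Function.ne_iff.1 h
      rw [Finset.prod_eq_zero (Finset.mem_univ j) (if_neg hj), zero_mul]
  | insert j s hj ih =>
    have hc : Commute (layerShift V (Pi.single j 1) + layerShift V (-Pi.single j (1 : ℤ)))
        (directionOp V s) :=
      (directionOp_commute_shift s _).add_left (directionOp_commute_shift s _)
    rw [directionOp, Finset.sum_insert hj, ← directionOp]
    rw [exp_smul_add_of_commute _ hc]
    rw [clm_mul_apply, exp_shift_apply j (m j), ih,
      ← mul_assoc]
    · congr 1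
      rw [← Finset.mul_prod_erase _ _ (Finset.mem_univ j),
        ← Finset.mul_prod_erase (Finset.univ) (fun i => if i ∈ insert j s then _ else _)
          (Finset.mem_univ j)]
      simp only [hj, if_false, Function.update_self, if_true, one_mul, Finset.mem_insert_self]
      congr 1
      refine Finset.prod_congr rfl fun i hi => ?_
      have hij : i ≠ j := Finset.ne_of_mem_erase hi
      simp only [Function.update_of_ne hij, Finset.mem_insert, hij, false_or]
    · intro n' v' hn'
      rw [ih, Finset.prod_eq_zero (Finset.mem_univ j), zero_mul]
      rw [if_neg hj, if_neg hn']

variable [Fintype V]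

/-- The part of the Hamiltonian acting inside the layers. -/
def layerOp (d : ℕ) (G : SimpleGraph V) [DecidableRel G.Adj] (Q : V → ℝ) :
    lp (fun _ : (Fin d → ℤ) × V => ℂ) 2 →L[ℂ] lp (fun _ : (Fin d → ℤ) × V => ℂ) 2 :=
  productHamiltonian d G Q - directionOp V Finset.univ

/-- The `2d` neighbours `n ± e_j` are distinct. -/
theorem sum_neighborFinset_latticeGraph (n : Fin d → ℤ) (F : (Fin d → ℤ) → ℂ) :
    ∑ y ∈ (latticeGraph d).neighborFinset n, F y =
      ∑ j, (F (n - Pi.single j 1) + F (n + Pi.single j 1)) := by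
  have h : (latticeGraph d).neighborFinset n = latticeNeighbors d n := by
    ext m
    rw [SimpleGraph.mem_neighborFinset, mem_latticeNeighbors, SimpleGraph.mem_neighborSet]
  have hinj : ∀ i j : Fin d, (Pi.single i 1 : Fin d → ℤ) = Pi.single j 1 → i = j := by
    intro i j hij
    by_contra hne
    have := congrFun hij i
    simp [hne] at this
  rw [h, latticeNeighbors, Finset.sum_union, Finset.sum_image, Finset.sum_image,
    ← Finset.sum_add_distrib]
  · exact Finset.sum_congr rfl fun j _ => add_comm _ _
  · exact fun i _ j _ hij => hinj i j (sub_right_injective hij)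
  · exact fun i _ j _ hij => hinj i j (add_right_injective n hij)
  · rw [Finset.disjoint_left]
    simp only [Finset.mem_image, Finset.mem_univ, true_and, not_exists, forall_exists_index]
    rintro _ i rfl j hij
    have := congrFun hij i
    simp only [Pi.sub_apply, Pi.add_apply, Pi.single_eq_same] at this
    by_cases hne : i = j
    · subst hne
      simp at this
      omega
    · simp [hne] at this

theorem layerOp_apply (G : SimpleGraph V) [DecidableRel G.Adj] (Q : V → ℝ)
    (f : lp (fun _ : (Fin d → ℤ) × V => ℂ) 2) (n : Fin d → ℤ) (v : V) :
    layerOp d G Q f (n, v) = ∑ w ∈ G.neighborFinset v, f (n, w) + (Q v : ℂ) * f (n, v) := by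
  rw [layerOp, sub_apply, lp.coeFn_sub, Pi.sub_apply, directionOp_apply,
    productHamiltonian, schrodingerOp_apply, SimpleGraph.neighborFinset_boxProd,
    Finset.sum_disjUnion, Finset.sum_product, Finset.sum_product]
  simp only [Finset.sum_singleton]
  rw [sum_neighborFinset_latticeGraph n (fun y => f (y, v))]
  ring

theorem layerOp_commute_shift (G : SimpleGraph V) [DecidableRel G.Adj] (Q : V → ℝ)
    (g : Fin d → ℤ) : Commute (layerShift V g) (layerOp d G Q) := by
  refine ContinuousLinearMap.ext fun f => lp.ext (funext fun ⟨n, v⟩ => ?_)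
  rw [clm_mul_apply, clm_mul_apply]
  simp only [layerShift_apply, layerOp_apply]

variable [DecidableEq V]

theorem layerOp_pow_single (G : SimpleGraph V) [DecidableRel G.Adj] (Q : V → ℝ) (k : ℕ)
    (n m : Fin d → ℤ) (p q : V) :
    (layerOp d G Q ^ k) (lp.single 2 (m, q) 1) (n, p) =
      if n = m then (finiteHamiltonian G Q ^ k) p q else 0 := by
  induction k generalizing p with
  | zero =>
    simp only [pow_zero, one_apply_eq_self, lp.single_apply, Pi.single_apply,
      Matrix.one_apply, Prod.mk.injEq, ite_and]
  | succ k ih =>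
    rw [pow_succ', clm_mul_apply, layerOp_apply]
    simp only [ih]
    split_ifs with h
    · rw [pow_succ', finiteHamiltonian, add_mul, Matrix.add_apply, Matrix.diagonal_mul,
        SimpleGraph.adjMatrix_mul_apply]
    · simp

theorem exp_layerOp_single (G : SimpleGraph V) [DecidableRel G.Adj] (Q : V → ℝ) (t : ℝ)
    (n m : Fin d → ℤ) (p q : V) :
    NormedSpace.exp ((Complex.I * t) • layerOp d G Q) (lp.single 2 (m, q) 1) (n, p) =
      if n = m then NormedSpace.exp ((Complex.I * t) • finiteHamiltonian G Q) p q else 0 := by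
  set z : ℂ := Complex.I * t
  have h1 := ((NormedSpace.exp_series_hasSum_exp' (𝕂 := ℂ) (z • layerOp d G Q)).mapL
    ((lp.evalCLM ℂ (fun _ : (Fin d → ℤ) × V => ℂ) 2 (n, p)).comp
      (ContinuousLinearMap.apply ℂ (lp (fun _ : (Fin d → ℤ) × V => ℂ) 2)
        (lp.single 2 (m, q) 1))))
  have h2 : HasSum (fun k : ℕ => ((k.factorial : ℂ)⁻¹ • (z • finiteHamiltonian G Q) ^ k) p q)
      (NormedSpace.exp (z • finiteHamiltonian G Q) p q) := by
    open scoped Matrix.Norms.Operator in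
    have := (NormedSpace.exp_series_hasSum_exp' (𝕂 := ℂ) (z • finiteHamiltonian G Q))
    exact Pi.hasSum.1 (Pi.hasSum.1 this p) q
  have hterm : ∀ k : ℕ, ((lp.evalCLM ℂ (fun _ : (Fin d → ℤ) × V => ℂ) 2 (n, p)).comp
      (ContinuousLinearMap.apply ℂ (lp (fun _ : (Fin d → ℤ) × V => ℂ) 2)
        (lp.single 2 (m, q) 1))) ((k.factorial : ℂ)⁻¹ • (z • layerOp d G Q) ^ k) =
      if n = m then ((k.factorial : ℂ)⁻¹ • (z • finiteHamiltonian G Q) ^ k) p q else 0 := by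
    intro k
    rw [map_smul, smul_pow, map_smul]
    change (k.factorial : ℂ)⁻¹ • z ^ k • (layerOp d G Q ^ k) (lp.single 2 (m, q) 1) (n, p) = _
    rw [layerOp_pow_single, smul_pow]
    split_ifs
    · rfl
    · simp
  simp only [hterm] at h1
  refine h1.unique ?_
  split_ifs
  · exact h2
  · exact hasSum_zero

/-- The kernel of the propagator: the directions of `ℤ^d` and the finite graph decouple. -/
theorem kernel_propagator_productHamiltonian (G : SimpleGraph V) [DecidableRel G.Adj] (Q : V → ℝ)
    (t : ℝ) (n m : Fin d → ℤ) (p q : V) :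
    kernel (propagator (productHamiltonian d G Q) t) (n, p) (m, q) =
      (∏ j : Fin d, Complex.I ^ (n j - m j) * (besselJ (n j - m j) (2 * t) : ℂ)) *
        (NormedSpace.exp ((Complex.I * (t : ℂ)) • finiteHamiltonian G Q)) p q := by
  have hc : Commute (directionOp V Finset.univ) (layerOp d G Q) :=
    Commute.sum_left _ _ _ fun _ _ =>
      (layerOp_commute_shift G Q _).add_left (layerOp_commute_shift G Q _)
  have hsplit : productHamiltonian d G Q = directionOp V Finset.univ + layerOp d G Q := by
    rw [layerOp, add_sub_cancel]
  rw [kernel, propagator, hsplit, exp_smul_add_of_commute _ hc,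
    clm_mul_apply, exp_directionOp_apply Finset.univ m]
  · simp only [Finset.mem_univ, if_true]
    rw [exp_layerOp_single, if_pos rfl]
  · intro n' v hn'
    rw [exp_layerOp_single, if_neg hn']

end Layers

/-! ### Bessel's integral -/

instance fact_two_pi_pos : Fact (0 < 2 * Real.pi) := ⟨Real.two_pi_pos⟩

theorem inner_fourier_eq_ite (T : ℝ) [hT : Fact (0 < T)] (k n : ℤ) :
    ((innerSL ℂ (fourierLp (T := T) 2 k)).comp
      (ContinuousMap.toLp 2 AddCircle.haarAddCircle ℂ)) (fourier n) = if n = k then 1 else 0 := by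
  have h := (orthonormal_iff_ite.1 (orthonormal_fourier (T := T))) k n
  simp only [eq_comm (a := n)]
  exact h

theorem inner_fourierLp_toLp (T : ℝ) [hT : Fact (0 < T)] (k : ℤ) (f : C(AddCircle T, ℂ)) :
    ((innerSL ℂ (fourierLp (T := T) 2 k)).comp
      (ContinuousMap.toLp 2 AddCircle.haarAddCircle ℂ)) f = fourierCoeff f k := by
  rw [← fourierCoeff_congr_ae (ContinuousMap.coeFn_toLp (p := 2) (𝕜 := ℂ)
    AddCircle.haarAddCircle f), ← fourierBasis_repr, HilbertBasis.repr_apply_apply,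
    coe_fourierBasis]
  rfl

/-- The integrand `e^{i(x sin θ - kθ)}` of Bessel's integral. -/
def besselIntegrand (k : ℤ) (x θ : ℝ) : ℂ :=
  Complex.exp (Complex.I * ((x * Real.sin θ - k * θ : ℝ) : ℂ))

/-- The generating function `e^{ix sin θ}` on the circle, as the product of the exponentials of
`(x/2) e^{iθ}` and `-(x/2) e^{-iθ}`. -/
def besselGenerating (x : ℝ) : C(AddCircle (2 * Real.pi), ℂ) :=
  NormedSpace.exp ((Complex.I * ((x / 2 : ℝ) : ℂ)) • ((-Complex.I) • fourier 1)) *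
    NormedSpace.exp ((Complex.I * ((x / 2 : ℝ) : ℂ)) • (Complex.I • fourier (-1)))

theorem besselGenerating_coe (x θ : ℝ) :
    besselGenerating x (θ : AddCircle (2 * Real.pi)) =
      Complex.exp (Complex.I * ((x * Real.sin θ : ℝ) : ℂ)) := by
  have hexp : ∀ (w : C(AddCircle (2 * Real.pi), ℂ)) (y : AddCircle (2 * Real.pi)),
      NormedSpace.exp w y = Complex.exp (w y) := by
    intro w y
    let : NormedAlgebra ℚ C(AddCircle (2 * Real.pi), ℂ) := NormedAlgebra.restrictScalars ℚ ℂ _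
    rw [Complex.exp_eq_exp_ℂ]
    exact NormedSpace.map_exp (ContinuousMap.evalAlgHom ℂ ℂ y)
      (continuous_eval_const y) w
  simp only [besselGenerating, ContinuousMap.mul_apply, hexp, ContinuousMap.smul_apply,
    smul_eq_mul, fourier_coe_apply]
  rw [← Complex.exp_add]
  congr 1
  have hpi : (Real.pi : ℂ) ≠ 0 := by exact_mod_cast Real.pi_ne_zero
  have e1 : ∀ n : ℤ, 2 * (Real.pi : ℂ) * Complex.I * n * θ / ((2 * Real.pi : ℝ) : ℂ) =
      n * θ * Complex.I := by
    intro n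
    push_cast
    field_simp
  rw [e1, e1]
  push_cast
  rw [Complex.sin]
  have e2 : (-1 : ℂ) * θ * Complex.I = - θ * Complex.I := by ring
  rw [e2, one_mul]
  ring_nf

theorem fourierCoeff_besselGenerating (k : ℤ) (x : ℝ) :
    fourierCoeff (besselGenerating x) k = (besselJ k x : ℂ) := by
  set T := 2 * Real.pi with hT
  set u : C(AddCircle T, ℂ) := (-Complex.I) • fourier 1 with hu
  set v : C(AddCircle T, ℂ) := Complex.I • fourier (-1) with hv
  have hpow : ∀ (n : ℤ) (a : ℕ), (fourier n : C(AddCircle T, ℂ)) ^ a = fourier (a * n) := by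
    intro n a
    induction a with
    | zero => ext; simp
    | succ a ih =>
      ext y
      rw [pow_succ, ih]
      simp only [ContinuousMap.mul_apply, ← fourier_add]
      push_cast
      ring_nf
  have key := map_exp_mul_exp ((innerSL ℂ (fourierLp (T := T) 2 k)).comp
      (ContinuousMap.toLp 2 AddCircle.haarAddCircle ℂ)) (Commute.all u v) k ((-Complex.I) ^ k)
      (fun a b => ?_) (x / 2)
  · have hI : (-Complex.I) ^ k * Complex.I ^ k = 1 := by
      rw [← mul_zpow]; simp
    rw [mul_div_cancel₀ _ (two_ne_zero), ← mul_assoc, hI, one_mul] at key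
    rw [← key, inner_fourierLp_toLp]
    rfl
  · have : u ^ a * v ^ b = ((-Complex.I) ^ a * Complex.I ^ b) • fourier ((a : ℤ) - b) := by
      rw [hu, hv, smul_pow, smul_pow, hpow, hpow, smul_mul_smul_comm]
      congr 1
      ext y
      rw [ContinuousMap.mul_apply, ← fourier_add]
      ring_nf
    rw [this, map_smul, inner_fourier_eq_ite]
    split_ifs with h
    · rw [smul_eq_mul, mul_one, ← h, zpow_sub₀ (neg_ne_zero.2 Complex.I_ne_zero), zpow_natCast,
        zpow_natCast, div_eq_mul_inv, ← inv_pow, inv_neg, Complex.inv_I, neg_neg]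
    · simp

theorem besselJ_eq_integral (k : ℤ) (x : ℝ) :
    (besselJ k x : ℂ) = (1 / (2 * Real.pi) : ℝ) •
      ∫ θ in (-Real.pi)..Real.pi, besselIntegrand k x θ := by
  rw [← fourierCoeff_besselGenerating, fourierCoeff_eq_intervalIntegral _ _ (-Real.pi),
    show -Real.pi + 2 * Real.pi = Real.pi by ring]
  congr 1
  refine intervalIntegral.integral_congr fun θ _ => ?_
  simp only [besselIntegrand]
  rw [besselGenerating_coe, fourier_coe_apply, smul_eq_mul, ← Complex.exp_add]
  congr 1
  have hpi : (Real.pi : ℂ) ≠ 0 := by exact_mod_cast Real.pi_ne_zero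
  push_cast
  field_simp
  ring

/-- Bessel's inequality for the generating function, which has modulus one. -/
theorem sum_sq_besselJ_le_one (s : Finset ℤ) (x : ℝ) : ∑ k ∈ s, besselJ k x ^ 2 ≤ 1 := by
  have h := (orthonormal_fourier (T := 2 * Real.pi)).sum_inner_products_le
    (ContinuousMap.toLp 2 AddCircle.haarAddCircle ℂ (besselGenerating x)) (s := s)
  have h1 : ∀ k : ℤ, inner ℂ (fourierLp (T := 2 * Real.pi) 2 k)
      (ContinuousMap.toLp 2 AddCircle.haarAddCircle ℂ (besselGenerating x)) =
      (besselJ k x : ℂ) := by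
    intro k
    rw [← fourierCoeff_besselGenerating, ← inner_fourierLp_toLp]
    rfl
  simp only [h1, Complex.norm_real, Real.norm_eq_abs, sq_abs] at h
  refine h.trans (pow_le_one₀ (norm_nonneg _) ?_)
  refine (MeasureTheory.Lp.norm_le_of_ae_bound zero_le_one (C := 1) ?_).trans
    (by simp [MeasureTheory.measureUnivNNReal])
  filter_upwards [ContinuousMap.coeFn_toLp (p := 2) (𝕜 := ℂ)
    AddCircle.haarAddCircle (besselGenerating x)] with y hy
  rw [hy]
  obtain ⟨θ, rfl⟩ := QuotientAddGroup.mk_surjective y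
  exact ((congrArg norm (besselGenerating_coe x θ)).trans
    (by rw [mul_comm, Complex.norm_exp_ofReal_mul_I])).le

theorem norm_besselIntegrand (k : ℤ) (x θ : ℝ) : ‖besselIntegrand k x θ‖ = 1 := by
  rw [besselIntegrand, mul_comm, Complex.norm_exp_ofReal_mul_I]

theorem continuous_besselIntegrand (k : ℤ) (x : ℝ) : Continuous (besselIntegrand k x) := by
  unfold besselIntegrand
  fun_prop

theorem abs_besselJ_eq (k : ℤ) (x : ℝ) :
    |besselJ k x| = 1 / (2 * Real.pi) * ‖∫ θ in (-Real.pi)..Real.pi, besselIntegrand k x θ‖ := by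
  have h := congrArg norm (besselJ_eq_integral k x)
  rwa [Complex.norm_real, Real.norm_eq_abs, norm_smul, Real.norm_eq_abs,
    abs_of_pos (one_div_pos.2 Real.two_pi_pos)] at h

theorem abs_besselJ_le_one (k : ℤ) (x : ℝ) : |besselJ k x| ≤ 1 := by
  rw [abs_besselJ_eq]
  have h := intervalIntegral.norm_integral_le_of_norm_le_const (a := -Real.pi) (b := Real.pi)
    (C := 1) (f := besselIntegrand k x) (fun θ _ => (norm_besselIntegrand k x θ).le)
  rw [abs_of_pos (by linarith [Real.pi_pos])] at h
  rw [div_mul_eq_mul_div, one_mul, div_le_one Real.two_pi_pos]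
  linarith

/-- The integrand has the derivative `i (x cos θ - k)` times itself. -/
theorem hasDerivAt_besselIntegrand (k : ℤ) (x θ : ℝ) :
    HasDerivAt (besselIntegrand k x)
      (Complex.I * ((x * Real.cos θ - k : ℝ) : ℂ) * besselIntegrand k x θ) θ := by
  have h1 : HasDerivAt (fun θ : ℝ => x * Real.sin θ - k * θ) (x * Real.cos θ - k) θ := by
    simpa [Pi.sub_def] using! ((Real.hasDerivAt_sin θ).const_mul x).sub
      ((hasDerivAt_id θ).const_mul (k : ℝ))
  have := (h1.ofReal_comp.const_mul Complex.I).cexp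
  convert! this using 1
  unfold besselIntegrand
  ring

theorem besselIntegrand_neg_pi (k : ℤ) (x : ℝ) :
    besselIntegrand k x (-Real.pi) = besselIntegrand k x Real.pi := by
  unfold besselIntegrand
  simp only [Real.sin_neg, Real.sin_pi, neg_zero, mul_zero, zero_sub]
  rw [Complex.exp_eq_exp_iff_exists_int]
  refine ⟨k, ?_⟩
  push_cast
  ring

/-- Integration by parts against the integrand of Bessel's integral. -/
theorem integral_deriv_besselIntegrand (k : ℤ) (x : ℝ) (h h' : ℝ → ℝ)
    (hh : ∀ θ, HasDerivAt h (h' θ) θ) (hc : Continuous h') (hp : h (-Real.pi) = h Real.pi) :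
    ∫ θ in (-Real.pi)..Real.pi, ((h' θ : ℂ) + Complex.I * ((h θ * (x * Real.cos θ - k) : ℝ) : ℂ)) *
      besselIntegrand k x θ = 0 := by
  have hcont : Continuous h := continuous_iff_continuousAt.2 fun θ => (hh θ).continuousAt
  have hb := continuous_besselIntegrand k x
  rw [intervalIntegral.integral_eq_sub_of_hasDerivAt (f := fun θ => (h θ : ℂ) *
    besselIntegrand k x θ)]
  · rw [hp, besselIntegrand_neg_pi, sub_self]
  · intro θ _
    convert! (hh θ).ofReal_comp.mul (hasDerivAt_besselIntegrand k x θ) using 1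
    push_cast
    ring
  · exact Continuous.intervalIntegrable (by fun_prop) _ _

theorem besselJ_recurrence (k : ℤ) (x : ℝ) :
    x * (besselJ (k - 1) x + besselJ (k + 1) x) = 2 * k * besselJ k x := by
  have h0 := integral_deriv_besselIntegrand k x (fun _ => 1) (fun _ => 0)
    (fun θ => hasDerivAt_const θ 1) continuous_const rfl
  have hc := continuous_besselIntegrand
  have h1 : ∀ θ, (((0 : ℝ) : ℂ) + Complex.I * ((1 * (x * Real.cos θ - k) : ℝ) : ℂ)) *
      besselIntegrand k x θ = (Complex.I / 2) * ((x : ℂ) * besselIntegrand (k - 1) x θ +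
        (x : ℂ) * besselIntegrand (k + 1) x θ - (2 * k : ℂ) * besselIntegrand k x θ) := by
    intro θ
    have e1 : besselIntegrand (k - 1) x θ =
        Complex.exp (θ * Complex.I) * besselIntegrand k x θ := by
      unfold besselIntegrand
      rw [← Complex.exp_add]
      congr 1
      push_cast
      ring
    have e2 : besselIntegrand (k + 1) x θ =
        Complex.exp (-θ * Complex.I) * besselIntegrand k x θ := by
      unfold besselIntegrand
      rw [← Complex.exp_add]
      congr 1
      push_cast
      ring
    rw [e1, e2]
    push_cast
    rw [Complex.cos]
    ring
  simp only [h1] at h0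
  rw [intervalIntegral.integral_const_mul, intervalIntegral.integral_sub,
    intervalIntegral.integral_add, intervalIntegral.integral_const_mul,
    intervalIntegral.integral_const_mul, intervalIntegral.integral_const_mul] at h0
  · have h2 := (mul_eq_zero.1 h0).resolve_left (by simp)
    have e := besselJ_eq_integral
    have : ((x * (besselJ (k - 1) x + besselJ (k + 1) x) : ℝ) : ℂ) =
        ((2 * k * besselJ k x : ℝ) : ℂ) := by
      push_cast
      rw [e, e, e]
      simp only [Complex.real_smul]
      linear_combination ((1 / (2 * Real.pi) : ℝ) : ℂ) * h2
    exact_mod_cast this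
  all_goals exact Continuous.intervalIntegrable (by fun_prop) _ _

/-! ### Bounds for Bessel functions from Bessel's inequality -/

theorem besselJ_neg (k : ℕ) (x : ℝ) : besselJ (-(k : ℤ)) x = (-1) ^ k * besselJ k x := by
  obtain _ | k := k
  · simp
  · rfl

theorem besselJ_neg_sq (k : ℕ) (x : ℝ) : besselJ (-(k : ℤ)) x ^ 2 = besselJ k x ^ 2 := by
  rw [besselJ_neg, mul_pow, ← pow_mul, mul_comm k 2, pow_mul, neg_one_sq, one_pow, one_mul]

theorem abs_besselJ_natAbs (k : ℤ) (x : ℝ) : |besselJ k x| = |besselJ k.natAbs x| := by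
  obtain h | h := k.natAbs_eq
  · rw [← h]
  · conv_lhs => rw [h]
    exact (sq_eq_sq_iff_abs_eq_abs _ _).1 (besselJ_neg_sq _ x)

/-- For `k ≠ 0` the orders `k` and `-k` share the total mass `1` of the squares; for `k = 0` the
three-term recurrence shows that the orders `±1` and `±2` carry at least as much mass. -/
theorem besselJ_sq_le_half (k : ℕ) {t : ℝ} (ht : 1 ≤ t) : besselJ k (2 * t) ^ 2 ≤ 1 / 2 := by
  obtain rfl | hk := Nat.eq_zero_or_pos k
  · have h := sum_sq_besselJ_le_one {0, 1, -1, 2, -2} (2 * t)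
    have e1 := besselJ_neg_sq 1 (2 * t)
    have e2 := besselJ_neg_sq 2 (2 * t)
    have hr := besselJ_recurrence 1 (2 * t)
    norm_num at h e1 e2 hr ⊢
    rw [e1, e2] at h
    set a := besselJ 0 (2 * t)
    set b := besselJ 1 (2 * t)
    set c := besselJ 2 (2 * t)
    have hb : t * a = b - t * c := by linarith
    have h1 : t ^ 2 * a ^ 2 ≤ (1 + t ^ 2) * (b ^ 2 + c ^ 2) := by
      rw [← mul_pow, hb]
      nlinarith [sq_nonneg (t * b + c)]
    have h2 : (1 + t ^ 2) * (b ^ 2 + c ^ 2) ≤ (2 * t ^ 2) * (b ^ 2 + c ^ 2) := by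
      gcongr
      nlinarith
    have h3 : t ^ 2 * a ^ 2 ≤ t ^ 2 * (2 * (b ^ 2 + c ^ 2)) := by linarith
    have h4 := le_of_mul_le_mul_left h3 (by positivity)
    linarith
  · have h := sum_sq_besselJ_le_one {(k : ℤ), -(k : ℤ)} (2 * t)
    rw [Finset.sum_pair (by omega), besselJ_neg_sq] at h
    linarith

/-! ### A Lorentzian integral over the circle -/

/-- The preimage of `z ∉ ℝ` in the unit disc under the Joukowski map `ζ ↦ (ζ + ζ⁻¹) / 2`. -/
theorem exists_joukowski (z : ℂ) (hz : z.im ≠ 0) :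
    ∃ ζ : ℂ, ‖ζ‖ < 1 ∧ ζ ≠ 0 ∧ ζ ^ 2 + 1 = 2 * z * ζ ∧
      ‖ζ ^ 2 - 1‖ ^ 2 = 4 * ‖ζ‖ ^ 2 * ‖z ^ 2 - 1‖ := by
  obtain ⟨w, hw⟩ := IsAlgClosed.exists_pow_nat_eq (z ^ 2 - 1) zero_lt_two
  have main : ∀ w : ℂ, w ^ 2 = z ^ 2 - 1 → ‖z + w‖ < 1 → ∃ ζ : ℂ, ‖ζ‖ < 1 ∧ ζ ≠ 0 ∧
      ζ ^ 2 + 1 = 2 * z * ζ ∧ ‖ζ ^ 2 - 1‖ ^ 2 = 4 * ‖ζ‖ ^ 2 * ‖z ^ 2 - 1‖ := by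
    intro w hw hlt
    refine ⟨z + w, hlt, fun h => ?_, by linear_combination hw, ?_⟩
    · have : (z + w) * (z - w) = 1 := by linear_combination -hw
      rw [h, zero_mul] at this
      exact zero_ne_one this
    · have : (z + w) ^ 2 - 1 = (z + w) * (2 * w) := by linear_combination -hw
      rw [this, ← hw, norm_mul, norm_mul, norm_pow]
      simp
      ring
  have hprod : (z + w) * (z - w) = 1 := by linear_combination -hw
  have hnorm : ‖z + w‖ * ‖z - w‖ = 1 := by rw [← norm_mul, hprod, norm_one]
  obtain h | h | h := lt_trichotomy ‖z + w‖ 1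
  · exact main w hw h
  · exfalso
    -- On the unit circle the inverse is the conjugate, so `2z` would be real.
    have hinv : z - w = (starRingEnd ℂ) (z + w) := by
      rw [← Complex.inv_eq_conj h]
      exact (eq_inv_of_mul_eq_one_right hprod)
    have him := congrArg Complex.im hinv
    simp at him
    exact hz (by linarith)
  · refine main (-w) (by rw [neg_sq, hw]) ?_
    rw [← sub_eq_add_neg]
    nlinarith [norm_nonneg (z - w)]

/-- With `z = (ζ + ζ⁻¹) / 2` and `y = e^{iθ}`, the integrand has a single pole `y = ζ` in the disc,
and Cauchy's formula gives the modulus of the integral. -/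
theorem norm_integral_cos_sub_inv (z : ℂ) (hz : z.im ≠ 0) :
    ‖∫ θ in (-Real.pi)..Real.pi, ((Real.cos θ : ℂ) - z)⁻¹‖ * √‖z ^ 2 - 1‖ = 2 * Real.pi := by
  obtain ⟨ζ, h1, h0, hq, hn⟩ := exists_joukowski z hz
  have hper : Function.Periodic (fun θ : ℝ => ((Real.cos θ : ℂ) - z)⁻¹) (2 * Real.pi) := by
    intro θ
    simp only [Real.cos_add_two_pi]
  have hshift := hper.intervalIntegral_add_eq (-Real.pi) 0
  rw [show -Real.pi + 2 * Real.pi = Real.pi by ring, zero_add] at hshift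
  rw [hshift]
  have hne : ∀ y : ℂ, ‖y‖ ≤ 1 → y * ζ - 1 ≠ 0 := by
    intro y hy h
    have h2 : ‖y * ζ‖ = 1 := by rw [sub_eq_zero.1 h, norm_one]
    rw [norm_mul] at h2
    nlinarith [norm_nonneg ζ, norm_nonneg y]
  have hf : DiffContOnCl ℂ (fun y : ℂ => 2 * ζ / (y * ζ - 1)) (Metric.ball 0 1) := by
    apply DifferentiableOn.diffContOnCl
    rw [closure_ball _ one_ne_zero]
    intro y hy
    have := hne y (by simpa using hy)
    exact DifferentiableAt.differentiableWithinAt (by fun_prop (disch := assumption))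
  have hC := hf.circleIntegral_sub_inv_smul (w := ζ) (by simpa using h1)
  have hint : (∮ y in C(0, 1), (y - ζ)⁻¹ • (2 * ζ / (y * ζ - 1))) =
      Complex.I * ∫ θ in (0 : ℝ)..(2 * Real.pi), ((Real.cos θ : ℂ) - z)⁻¹ := by
    rw [circleIntegral, ← intervalIntegral.integral_const_mul]
    refine intervalIntegral.integral_congr fun θ _ => ?_
    simp only [deriv_circleMap, circleMap, zero_add, Complex.ofReal_one, one_mul, smul_eq_mul]
    set e := Complex.exp (θ * Complex.I) with he
    have he1 : ‖e‖ = 1 := Complex.norm_exp_ofReal_mul_I θ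
    have he0 : e ≠ 0 := Complex.exp_ne_zero _
    have hd1 := hne e he1.le
    have hd2 : e - ζ ≠ 0 := by
      intro h
      rw [sub_eq_zero.1 h] at he1
      linarith
    have hcos : (Real.cos θ : ℂ) = (e + e⁻¹) / 2 := by
      rw [Complex.ofReal_cos, Complex.cos, he, ← Complex.exp_neg]
      ring_nf
    have hz' : z = (ζ ^ 2 + 1) / (2 * ζ) := by
      field_simp
      linear_combination -hq
    have hcz : (Real.cos θ : ℂ) - z = (e - ζ) * (e * ζ - 1) / (2 * (e * ζ)) := by
      rw [hcos, hz']
      field_simp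
      ring
    rw [hcz]
    field_simp
  rw [hint] at hC
  have hnorm := congrArg norm hC
  rw [norm_mul, Complex.norm_I, one_mul] at hnorm
  rw [hnorm, smul_eq_mul, norm_mul, norm_div, ← sq, norm_mul, norm_mul, norm_mul,
    Complex.norm_I, Complex.norm_real, Real.norm_eq_abs, abs_of_pos Real.pi_pos]
  have hd := hne ζ h1.le
  rw [← sq] at hd
  have hd' : ‖ζ ^ 2 - 1‖ ≠ 0 := norm_ne_zero_iff.2 hd
  have hs : ‖ζ ^ 2 - 1‖ = 2 * ‖ζ‖ * √‖z ^ 2 - 1‖ := by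
    have hsq : (2 * ‖ζ‖ * √‖z ^ 2 - 1‖) ^ 2 = ‖ζ ^ 2 - 1‖ ^ 2 := by
      rw [hn, mul_pow, Real.sq_sqrt (norm_nonneg _)]
      ring
    exact ((pow_left_inj₀ (by positivity) (norm_nonneg _) two_ne_zero).1 hsq).symm
  rw [show ‖(2 : ℂ)‖ = 2 by simp]
  field_simp
  rw [hs]

/-- A Lorentzian of width `m` in `cos θ` is `m` times the imaginary part of `1 / (cos θ - z)`, where
`z = κ + i m`; the hypothesis on `N` says that `N ≤ |z² - 1|`. -/
theorem integral_lorentz_le (κ : ℝ) {m N : ℝ} (hm : 0 < m) (hN : 0 < N)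
    (h : N ^ 2 ≤ (1 - κ ^ 2 - m ^ 2) ^ 2 + 4 * m ^ 2) :
    ∫ θ in (-Real.pi)..Real.pi, m ^ 2 / (m ^ 2 + (Real.cos θ - κ) ^ 2) ≤
      2 * Real.pi * (m / √N) := by
  set z : ℂ := ⟨κ, m⟩ with hz
  have hzim : z.im ≠ 0 := hm.ne'
  have hI := norm_integral_cos_sub_inv z hzim
  have hNz : N ≤ ‖z ^ 2 - 1‖ := by
    refine le_of_sq_le_sq (h.trans (le_of_eq ?_)) (norm_nonneg _)
    rw [Complex.sq_norm, Complex.normSq_apply]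
    simp [hz, sq]
    ring
  have hne : ∀ θ : ℝ, (Real.cos θ : ℂ) - z ≠ 0 := by
    intro θ h0
    have := congrArg Complex.im h0
    simp [hz] at this
    exact hm.ne' this
  have hcont : Continuous fun θ : ℝ => ((Real.cos θ : ℂ) - z)⁻¹ :=
    Continuous.inv₀ (by fun_prop) hne
  have him : ∫ θ in (-Real.pi)..Real.pi, m ^ 2 / (m ^ 2 + (Real.cos θ - κ) ^ 2) =
      m * (∫ θ in (-Real.pi)..Real.pi, ((Real.cos θ : ℂ) - z)⁻¹).im := by
    have h2 := Complex.imCLM.intervalIntegral_comp_comm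
      (hcont.intervalIntegrable (μ := MeasureTheory.volume) (-Real.pi) Real.pi)
    rw [← Complex.imCLM_apply, ← h2, ← intervalIntegral.integral_const_mul]
    refine intervalIntegral.integral_congr fun θ _ => ?_
    simp only [Complex.imCLM_apply, Complex.inv_im, Complex.normSq_apply, Complex.sub_im,
      Complex.sub_re, Complex.ofReal_re, Complex.ofReal_im, hz]
    rw [show (Real.cos θ - κ) * (Real.cos θ - κ) + (0 - m) * (0 - m) =
      m ^ 2 + (Real.cos θ - κ) ^ 2 by ring]
    ring
  rw [him]
  have hle := (le_abs_self _).trans (Complex.abs_im_le_norm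
    (∫ θ in (-Real.pi)..Real.pi, ((Real.cos θ : ℂ) - z)⁻¹))
  have hsN : 0 < √N := Real.sqrt_pos.2 hN
  have hI' : ‖∫ θ in (-Real.pi)..Real.pi, ((Real.cos θ : ℂ) - z)⁻¹‖ * √N ≤ 2 * Real.pi := by
    rw [← hI]
    gcongr
  rw [mul_div_assoc', le_div_iff₀ hsN]
  nlinarith [mul_le_mul_of_nonneg_left hle hm.le]

/-! ### The uniform decay of `J_k` -/

/-- The odd multiplier `p / (p² + μ²)`, a bounded substitute for `1 / p`. -/
def lorentzMul (μ p : ℝ) : ℝ := p / (p ^ 2 + μ ^ 2)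

/-- The derivative of `lorentzMul μ`. -/
def lorentzMulDeriv (μ p : ℝ) : ℝ := (μ ^ 2 - p ^ 2) / (p ^ 2 + μ ^ 2) ^ 2

theorem hasDerivAt_lorentzMul {μ : ℝ} (hμ : 0 < μ) (p : ℝ) :
    HasDerivAt (lorentzMul μ) (lorentzMulDeriv μ p) p := by
  have h : p ^ 2 + μ ^ 2 ≠ 0 := by positivity
  have := (hasDerivAt_id p).div (((hasDerivAt_id p).pow 2).add_const (μ ^ 2)) h
  convert! this using 1
  simp [lorentzMulDeriv]
  ring

theorem continuous_lorentzMulDeriv {μ : ℝ} (hμ : 0 < μ) : Continuous (lorentzMulDeriv μ) := by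
  unfold lorentzMulDeriv
  refine Continuous.div (by fun_prop) (by fun_prop) fun p => ?_
  positivity

theorem lorentzMulDeriv_nonneg {μ : ℝ} (hμ : 0 < μ) {p : ℝ} (h1 : -μ ≤ p)
    (h2 : p ≤ μ) : 0 ≤ lorentzMulDeriv μ p :=
  div_nonneg (by nlinarith) (by positivity)

theorem lorentzMulDeriv_nonpos {μ : ℝ} (hμ : 0 < μ) {p : ℝ} (h : p ≤ -μ ∨ μ ≤ p) :
    lorentzMulDeriv μ p ≤ 0 := by
  refine div_nonpos_of_nonpos_of_nonneg ?_ (by positivity)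
  obtain h | h := h <;> nlinarith

theorem lorentzMul_self {μ : ℝ} (hμ : 0 < μ) : lorentzMul μ μ = 1 / (2 * μ) := by
  unfold lorentzMul
  field_simp
  norm_num

theorem lorentzMul_neg_self {μ : ℝ} (hμ : 0 < μ) : lorentzMul μ (-μ) = -(1 / (2 * μ)) := by
  unfold lorentzMul
  field_simp
  norm_num

theorem integral_lorentzMulDeriv {μ : ℝ} (hμ : 0 < μ) (a b : ℝ) :
    ∫ p in a..b, lorentzMulDeriv μ p = lorentzMul μ b - lorentzMul μ a :=
  intervalIntegral.integral_eq_sub_of_hasDerivAt (fun p _ => hasDerivAt_lorentzMul hμ p)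
    ((continuous_lorentzMulDeriv hμ).intervalIntegrable _ _)

/-- The multiplier falls from `0` to `-1/(2μ)` and then rises to `1/(2μ)`. -/
theorem integral_abs_lorentzMulDeriv_le_three {μ : ℝ} (hμ : 0 < μ) {a b : ℝ}
    (ha : a ≤ -μ) (hb : b ≤ μ) (hab : a ≤ b) :
    ∫ p in a..b, |lorentzMulDeriv μ p| ≤ 3 / (2 * μ) := by
  have hi : ∀ a b : ℝ, IntervalIntegrable (fun p => |lorentzMulDeriv μ p|)
      MeasureTheory.volume a b :=
    fun a b => (continuous_lorentzMulDeriv hμ).abs.intervalIntegrable _ _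
  have hext : ∫ p in a..b, |lorentzMulDeriv μ p| ≤ ∫ p in a..μ, |lorentzMulDeriv μ p| :=
    intervalIntegral.integral_mono_interval le_rfl hab hb
      (Filter.Eventually.of_forall fun _ => abs_nonneg _) (hi _ _)
  refine hext.trans ?_
  rw [← intervalIntegral.integral_add_adjacent_intervals (hi a (-μ)) (hi (-μ) μ)]
  have e1 : ∫ p in a..(-μ), |lorentzMulDeriv μ p| = ∫ p in a..(-μ), -lorentzMulDeriv μ p := by
    refine intervalIntegral.integral_congr fun p hp => ?_
    rw [Set.uIcc_of_le ha] at hp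
    exact abs_of_nonpos (lorentzMulDeriv_nonpos hμ (Or.inl hp.2))
  have e2 : ∫ p in (-μ)..μ, |lorentzMulDeriv μ p| = ∫ p in (-μ)..μ, lorentzMulDeriv μ p := by
    refine intervalIntegral.integral_congr fun p hp => ?_
    rw [Set.uIcc_of_le (by linarith)] at hp
    exact abs_of_nonneg (lorentzMulDeriv_nonneg hμ hp.1 hp.2)
  rw [e1, e2, intervalIntegral.integral_neg, integral_lorentzMulDeriv hμ,
    integral_lorentzMulDeriv hμ, lorentzMul_self hμ, lorentzMul_neg_self hμ]
  have h0 : lorentzMul μ a ≤ 0 :=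
    div_nonpos_of_nonpos_of_nonneg (by linarith) (by positivity)
  have e3 : 3 / (2 * μ) = 3 * (1 / (2 * μ)) := by ring
  linarith

/-- Beyond `μ` the multiplier falls back to `0`, which adds `1/(2μ)` to the variation. -/
theorem integral_abs_lorentzMulDeriv_le_four {μ : ℝ} (hμ : 0 < μ) {a b : ℝ}
    (ha : a ≤ -μ) (hb : μ ≤ b) :
    ∫ p in a..b, |lorentzMulDeriv μ p| ≤ 2 / μ := by
  have hi : ∀ a b : ℝ, IntervalIntegrable (fun p => |lorentzMulDeriv μ p|)
      MeasureTheory.volume a b :=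
    fun a b => (continuous_lorentzMulDeriv hμ).abs.intervalIntegrable _ _
  rw [← intervalIntegral.integral_add_adjacent_intervals (hi a μ) (hi μ b)]
  have h1 := integral_abs_lorentzMulDeriv_le_three hμ ha le_rfl (by linarith)
  have e1 : ∫ p in μ..b, |lorentzMulDeriv μ p| = ∫ p in μ..b, -lorentzMulDeriv μ p := by
    refine intervalIntegral.integral_congr fun p hp => ?_
    rw [Set.uIcc_of_le hb] at hp
    exact abs_of_nonpos (lorentzMulDeriv_nonpos hμ (Or.inr hp.1))
  rw [e1, intervalIntegral.integral_neg, integral_lorentzMulDeriv hμ, lorentzMul_self hμ]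
  have h0 : 0 ≤ lorentzMul μ b := div_nonneg (by linarith) (by positivity)
  have e3 : 3 / (2 * μ) + 1 / (2 * μ) = 2 / μ := by field_simp; norm_num
  linarith

/-- The total variation of the multiplier along the phase derivative `x cos θ - k`, over the
whole circle, is twice its variation over the range of that derivative. -/
theorem integral_abs_deriv_phase {μ : ℝ} (hμ : 0 < μ) {x : ℝ} (hx : 0 ≤ x) (k : ℝ) :
    ∫ θ in (-Real.pi)..Real.pi, |lorentzMulDeriv μ (x * Real.cos θ - k) * (-(x * Real.sin θ))| =
      2 * ∫ p in (-x - k)..(x - k), |lorentzMulDeriv μ p| := by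
  have hc := continuous_lorentzMulDeriv hμ
  set F : ℝ → ℝ := fun θ => |lorentzMulDeriv μ (x * Real.cos θ - k) * (-(x * Real.sin θ))| with hF
  have hFc : Continuous F := by
    have : Continuous fun θ : ℝ => x * Real.cos θ - k := by fun_prop
    have h2 := hc.comp this
    exact (h2.mul (by fun_prop)).abs
  have heven : ∫ θ in (-Real.pi)..0, F θ = ∫ θ in (0 : ℝ)..Real.pi, F θ := by
    have := intervalIntegral.integral_comp_neg F (a := 0) (b := Real.pi)
    rw [neg_zero] at this
    rw [← this]
    refine intervalIntegral.integral_congr fun θ _ => ?_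
    simp [hF]
  have hhalf : ∫ θ in (0 : ℝ)..Real.pi, F θ = ∫ p in (-x - k)..(x - k), |lorentzMulDeriv μ p| := by
    have hsub := intervalIntegral.integral_comp_mul_deriv (a := 0) (b := Real.pi)
      (f := fun θ => x * Real.cos θ - k) (f' := fun θ => -(x * Real.sin θ))
      (g := fun p => |lorentzMulDeriv μ p|) (fun θ _ => by
        simpa using! ((Real.hasDerivAt_cos θ).const_mul x).sub_const k)
      (Continuous.continuousOn (by fun_prop)) hc.abs
    simp only [Real.cos_zero, Real.cos_pi, mul_one, mul_neg] at hsub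
    rw [intervalIntegral.integral_symm (-x - k)] at hsub
    rw [← neg_inj, ← hsub, ← intervalIntegral.integral_neg]
    refine intervalIntegral.integral_congr fun θ hθ => ?_
    rw [Set.uIcc_of_le Real.pi_pos.le] at hθ
    have hs := mul_nonneg hx (Real.sin_nonneg_of_nonneg_of_le_pi hθ.1 hθ.2)
    simp only [hF, Function.comp]
    rw [abs_mul, abs_neg, abs_of_nonneg hs]
  rw [← intervalIntegral.integral_add_adjacent_intervals (hFc.intervalIntegrable _ 0)
    (hFc.intervalIntegrable 0 _), heven, hhalf]
  ring

/-- A smoothed form of van der Corput's lemma: integrating by parts against the multiplier leaves a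
Lorentzian around the stationary points and the variation of the multiplier. -/
theorem two_pi_mul_abs_besselJ_le {μ : ℝ} (hμ : 0 < μ) (k : ℤ) {x : ℝ} (hx : 0 ≤ x) :
    2 * Real.pi * |besselJ k x| ≤
      (∫ θ in (-Real.pi)..Real.pi, μ ^ 2 / (μ ^ 2 + (x * Real.cos θ - k) ^ 2)) +
        2 * ∫ p in (-x - k)..(x - k), |lorentzMulDeriv μ p| := by
  rw [abs_besselJ_eq, ← integral_abs_deriv_phase hμ hx (k : ℝ)]
  have hpi : 2 * Real.pi ≠ 0 := Real.two_pi_pos.ne'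
  rw [← mul_assoc, mul_one_div_cancel hpi, one_mul]
  set p : ℝ → ℝ := fun θ => x * Real.cos θ - k with hp
  have hpc : Continuous p := by fun_prop
  have hb := continuous_besselIntegrand k x
  set h : ℝ → ℝ := fun θ => lorentzMul μ (p θ) with hh
  set h' : ℝ → ℝ := fun θ => lorentzMulDeriv μ (p θ) * (-(x * Real.sin θ)) with hh'
  have hder : ∀ θ, HasDerivAt h (h' θ) θ := by
    intro θ
    have h1 : HasDerivAt p (-(x * Real.sin θ)) θ := by
      simpa [hp] using! ((Real.hasDerivAt_cos θ).const_mul x).sub_const (k : ℝ)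
    exact (hasDerivAt_lorentzMul hμ (p θ)).comp θ h1
  have hc : Continuous h := continuous_iff_continuousAt.2 fun θ => (hder θ).continuousAt
  have hc' : Continuous h' :=
    ((continuous_lorentzMulDeriv hμ).comp hpc).mul (by fun_prop)
  have hzero := integral_deriv_besselIntegrand k x h h' hder hc'
    (by simp only [hh, hp, Real.cos_neg])
  have hL : ∀ θ, 1 - h θ * p θ = μ ^ 2 / (μ ^ 2 + p θ ^ 2) := by
    intro θ
    have : p θ ^ 2 + μ ^ 2 ≠ 0 := by positivity
    have h2 : μ ^ 2 + p θ ^ 2 ≠ 0 := by positivity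
    simp only [hh, lorentzMul]
    field_simp
    ring
  have hLc : Continuous fun θ => 1 - h θ * p θ := by fun_prop
  have hsplit : ∫ θ in (-Real.pi)..Real.pi, besselIntegrand k x θ =
      (∫ θ in (-Real.pi)..Real.pi, ((1 - h θ * p θ : ℝ) : ℂ) * besselIntegrand k x θ) +
      ∫ θ in (-Real.pi)..Real.pi, (Complex.I * (h' θ : ℂ)) * besselIntegrand k x θ := by
    have h2 : ∫ θ in (-Real.pi)..Real.pi, (-Complex.I) * (((h' θ : ℂ) + Complex.I *
        ((h θ * p θ : ℝ) : ℂ)) * besselIntegrand k x θ) = 0 := by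
      rw [intervalIntegral.integral_const_mul, hzero, mul_zero]
    rw [← intervalIntegral.integral_add, ← sub_zero (∫ θ in (-Real.pi)..Real.pi,
      besselIntegrand k x θ), ← h2, ← intervalIntegral.integral_sub]
    · refine intervalIntegral.integral_congr fun θ _ => ?_
      push_cast
      linear_combination (h θ * p θ * besselIntegrand k x θ : ℂ) * Complex.I_mul_I
    all_goals exact Continuous.intervalIntegrable (by fun_prop) _ _
  have hle : -Real.pi ≤ Real.pi := by linarith [Real.pi_pos]
  rw [hsplit]
  refine (norm_add_le _ _).trans (add_le_add ?_ ?_)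
  · refine intervalIntegral.norm_integral_le_of_norm_le hle
      (Filter.Eventually.of_forall fun θ _ => ?_) ?_
    · rw [norm_mul, norm_besselIntegrand, mul_one, Complex.norm_real, hL, Real.norm_eq_abs,
        abs_of_nonneg (by positivity)]
    · have : (fun θ => μ ^ 2 / (μ ^ 2 + (x * Real.cos θ - k) ^ 2)) = fun θ => 1 - h θ * p θ :=
        funext fun θ => (hL θ).symm
      rw [this]
      exact hLc.intervalIntegrable _ _
  · refine intervalIntegral.norm_integral_le_of_norm_le hle
      (Filter.Eventually.of_forall fun θ _ => ?_) (hc'.abs.intervalIntegrable _ _)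
    rw [norm_mul, norm_mul, Complex.norm_I, one_mul, norm_besselIntegrand, mul_one,
      Complex.norm_real, Real.norm_eq_abs]

/-- The decay of `J_k` for large arguments. With `μ = 7r/4` the Lorentzian and the variation
contribute comparable amounts; the variation is smaller in the transition regime `x - k ≤ μ`, the
Lorentzian outside it. -/
theorem abs_besselJ_le_of_large (k : ℕ) {r : ℝ} (hr : 1.409 ≤ r) :
    |besselJ k (2 * r ^ 3)| ≤ 0.99 / r := by
  have hr0 : 0 < r := by linarith
  set x := 2 * r ^ 3 with hx
  have hx0 : 0 < x := by positivity
  set μ := 7 / 4 * r with hμ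
  have hμ0 : 0 < μ := by positivity
  set m := 7 / 8 / r ^ 2 with hm
  have hm0 : 0 < m := by positivity
  have hmx : μ = m * x := by
    rw [hμ, hm, hx]
    field_simp
    norm_num
  have hr2 : 1.985 ≤ r ^ 2 := by nlinarith
  have hm1 : m ≤ 0.441 := by
    rw [hm, div_le_iff₀ (by positivity)]
    linarith
  set κ := (k : ℝ) / x with hκ
  have hκ0 : 0 ≤ κ := by positivity
  have hkx : (k : ℝ) = κ * x := by rw [hκ]; field_simp
  have hL : ∫ θ in (-Real.pi)..Real.pi, μ ^ 2 / (μ ^ 2 + (x * Real.cos θ - (k : ℤ)) ^ 2) =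
      ∫ θ in (-Real.pi)..Real.pi, m ^ 2 / (m ^ 2 + (Real.cos θ - κ) ^ 2) := by
    refine intervalIntegral.integral_congr fun θ _ => ?_
    simp only [Int.cast_natCast]
    rw [hmx, hkx, show (m * x) ^ 2 + (x * Real.cos θ - κ * x) ^ 2 =
      (m ^ 2 + (Real.cos θ - κ) ^ 2) * x ^ 2 by ring, mul_pow,
      mul_div_mul_right _ _ (by positivity)]
  have hmain := two_pi_mul_abs_besselJ_le hμ0 k hx0.le
  rw [hL] at hmain
  have hleft : -x - (k : ℝ) ≤ -μ := by
    rw [hmx, hkx]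
    nlinarith
  have hπ := Real.pi_gt_d2
  -- The mean of the Lorentzian is `m / √N`, for a lower bound `N` of `|z² - 1|`, `z = κ + i m`.
  have hsq : ∀ N α : ℝ, 0 < N → 0 < α → 7 / 8 * m ≤ α ^ 2 * N → m / √N ≤ α / r := by
    intro N α hN hα h
    rw [div_le_div_iff₀ (Real.sqrt_pos.2 hN) hr0]
    refine le_of_sq_le_sq ?_ (by positivity)
    rw [mul_pow, mul_pow, Real.sq_sqrt hN.le]
    have : m ^ 2 * r ^ 2 = 7 / 8 * m := by rw [hm]; field_simp
    rwa [this]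
  have finish : ∀ N α T : ℝ, 0 < N → 0 < α → 7 / 8 * m ≤ α ^ 2 * N →
      N ^ 2 ≤ (1 - κ ^ 2 - m ^ 2) ^ 2 + 4 * m ^ 2 →
      ∫ p in (-x - (k : ℝ))..(x - k), |lorentzMulDeriv μ p| ≤ T / r →
      α * 3.14 + T ≤ 0.99 * 3.14 → α ≤ 0.99 → |besselJ k x| ≤ 0.99 / r := by
    intro N α T hN hα h1 h2 h3 h4 h5
    have hI := integral_lorentz_le κ hm0 hN h2
    have hs := hsq N α hN hα h1
    have h6 : 2 * Real.pi * |besselJ k x| ≤ 2 * Real.pi * (α / r) + 2 * (T / r) := by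
      refine hmain.trans (add_le_add (hI.trans ?_) ?_)
      · gcongr
      · simp only [Int.cast_natCast]
        gcongr
    have h7 : 2 * Real.pi * (α / r) + 2 * (T / r) ≤ 2 * Real.pi * (0.99 / r) := by
      have : 0 ≤ 2 * ((0.99 - α) * Real.pi - T) / r :=
        div_nonneg (by nlinarith) hr0.le
      have e : 2 * Real.pi * (0.99 / r) - (2 * Real.pi * (α / r) + 2 * (T / r)) =
        2 * ((0.99 - α) * Real.pi - T) / r := by ring
      linarith
    exact le_of_mul_le_mul_left (h6.trans h7) Real.two_pi_pos
  by_cases hcase : x - k ≤ μ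
  · refine finish (2 * m) 0.6615 (6 / 7) (by positivity) (by norm_num) (by nlinarith)
      (by nlinarith [sq_nonneg (1 - κ ^ 2 - m ^ 2)]) ?_ (by norm_num) (by norm_num)
    refine (integral_abs_lorentzMulDeriv_le_three hμ0 hleft hcase (by linarith)).trans
      (le_of_eq ?_)
    rw [hμ]
    field_simp
    norm_num
  · have hκ1 : κ ≤ 1 - m := by
      rw [hmx, hkx, not_le] at hcase
      nlinarith
    refine finish (2.29 * m) 0.6185 (8 / 7) (by positivity) (by norm_num) (by nlinarith)
      ?_ ?_ (by norm_num) (by norm_num)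
    · have h1 : 2 * m * (1 - m) ≤ 1 - κ ^ 2 - m ^ 2 := by nlinarith
      have h2 : 2 * m * 0.559 ≤ 1 - κ ^ 2 - m ^ 2 := by nlinarith
      nlinarith
    · refine (integral_abs_lorentzMulDeriv_le_four hμ0 hleft (not_le.1 hcase).le).trans
        (le_of_eq ?_)
      rw [hμ]
      field_simp
      norm_num

/-- The bound behind the dispersive estimate: at each time, `|J_k(2t)|` stays below `t ^ (-1/3)` by
a margin uniform in the order `k`. -/
theorem exists_besselJ_bound {t : ℝ} (ht : 0 < t) :
    ∃ C : ℝ, 0 ≤ C ∧ C < 1 / t ^ ((1 : ℝ) / 3) ∧ ∀ k : ℤ, |besselJ k (2 * t)| ≤ C := by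
  set r := t ^ ((1 : ℝ) / 3) with hr
  have hr0 : 0 < r := Real.rpow_pos_of_pos ht _
  have hr3 : r ^ 3 = t := by
    rw [hr, ← Real.rpow_natCast, ← Real.rpow_mul ht.le]
    norm_num
  obtain h1 | h1 := lt_or_ge t 1
  · refine ⟨1, zero_le_one, ?_, fun k => abs_besselJ_le_one k _⟩
    rw [lt_div_iff₀ hr0, one_mul]
    by_contra! hc
    have := one_le_pow₀ hc (n := 3)
    linarith
  obtain h2 | h2 := lt_or_ge r 1.409
  · refine ⟨0.7072, by norm_num, ?_, fun k => ?_⟩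
    · rw [lt_div_iff₀ hr0]
      linarith
    · rw [abs_besselJ_natAbs]
      refine abs_le_of_sq_le_sq ((besselJ_sq_le_half _ h1).trans (by norm_num)) (by norm_num)
  · refine ⟨0.99 / r, by positivity, ?_, fun k => ?_⟩
    · gcongr
      norm_num
    · rw [abs_besselJ_natAbs, ← hr3]
      exact abs_besselJ_le_of_large _ h2

/-! ### Sharpness of the decay of `J_k` -/

/-- The total mass of the bump `cos²(θ/2) ^ M`. -/
def bumpMass (M : ℕ) : ℝ := ∫ θ in (-Real.pi)..Real.pi, (Real.cos (θ / 2) ^ 2) ^ M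

theorem bumpMass_succ (M : ℕ) : bumpMass (M + 1) = (2 * M + 1) / (2 * M + 2) * bumpMass M := by
  have key : ∀ n : ℕ, bumpMass n = 2 * ∫ u in (-(Real.pi / 2))..(Real.pi / 2),
      Real.cos u ^ (2 * n) := by
    intro n
    have := intervalIntegral.integral_comp_div (a := -Real.pi) (b := Real.pi)
      (fun u => Real.cos u ^ (2 * n)) two_ne_zero
    rw [smul_eq_mul, neg_div] at this
    rw [← this, bumpMass]
    simp only [pow_mul]
  rw [key, key, mul_add, mul_one, integral_cos_pow]
  simp only [Real.cos_neg, Real.cos_pi_div_two, ne_eq, Nat.add_eq_zero_iff, one_ne_zero, and_false,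
    not_false_eq_true, zero_pow, zero_mul, sub_zero, zero_div, zero_add]
  push_cast
  ring

theorem bumpMass_zero : bumpMass 0 = 2 * Real.pi := by
  simp [bumpMass]
  ring

theorem bumpMass_pos (M : ℕ) : 0 < bumpMass M := by
  induction M with
  | zero => rw [bumpMass_zero]; exact Real.two_pi_pos
  | succ M ih => rw [bumpMass_succ]; positivity

/-- A form of the Wallis bound: the bump has mass at least `π / √M`. -/
theorem pi_sq_le_mul_bumpMass_sq {M : ℕ} (hM : 1 ≤ M) : Real.pi ^ 2 ≤ M * bumpMass M ^ 2 := by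
  induction M, hM using Nat.le_induction with
  | base =>
    have := bumpMass_succ 0
    rw [bumpMass_zero] at this
    rw [show bumpMass 1 = Real.pi by rw [this]; push_cast; ring]
    simp
  | succ M hM ih =>
    refine ih.trans ?_
    have hM' : (1 : ℝ) ≤ M := by exact_mod_cast hM
    rw [bumpMass_succ, mul_pow, ← mul_assoc]
    refine mul_le_mul_of_nonneg_right ?_ (sq_nonneg _)
    rw [div_pow, mul_div_assoc', le_div_iff₀ (by positivity)]
    push_cast
    nlinarith

theorem integral_bump_mul_sin (M : ℕ) :
    ∫ θ in (-Real.pi)..Real.pi, (Real.cos (θ / 2) ^ 2) ^ M * Real.sin (θ / 2) ^ 2 =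
      bumpMass M / (2 * M + 2) := by
  have h : ∀ θ : ℝ, (Real.cos (θ / 2) ^ 2) ^ M * Real.sin (θ / 2) ^ 2 =
      (Real.cos (θ / 2) ^ 2) ^ M - (Real.cos (θ / 2) ^ 2) ^ (M + 1) := by
    intro θ
    rw [Real.sin_sq]
    ring
  simp only [h]
  rw [intervalIntegral.integral_sub, ← bumpMass, ← bumpMass, bumpMass_succ]
  · field_simp
    ring
  all_goals exact Continuous.intervalIntegrable (by fun_prop) _ _

theorem integral_bump_mul_sin_pow_six (M : ℕ) :
    ∫ θ in (-Real.pi)..Real.pi, (Real.cos (θ / 2) ^ 2) ^ M * (Real.sin (θ / 2) ^ 2) ^ 3 =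
      15 * bumpMass M / ((2 * M + 2) * (2 * M + 4) * (2 * M + 6)) := by
  set F : ℕ → ℝ → ℝ := fun n θ => (Real.cos (θ / 2) ^ 2) ^ n * Real.sin (θ / 2) ^ 2 with hF
  have h : ∀ θ : ℝ, (Real.cos (θ / 2) ^ 2) ^ M * (Real.sin (θ / 2) ^ 2) ^ 3 =
      F M θ - 2 * F (M + 1) θ + F (M + 2) θ := by
    intro θ
    simp only [hF, Real.sin_sq]
    ring
  have hc : ∀ n, Continuous (F n) := fun n => by simp only [hF]; fun_prop
  simp only [h]
  rw [intervalIntegral.integral_add, intervalIntegral.integral_sub,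
    intervalIntegral.integral_const_mul]
  · simp only [hF]
    rw [integral_bump_mul_sin, integral_bump_mul_sin, integral_bump_mul_sin, bumpMass_succ (M + 1),
      bumpMass_succ]
    push_cast
    have h1 : (2 * M + 2 : ℝ) ≠ 0 := by positivity
    have h2 : (2 * (M + 1) + 2 : ℝ) ≠ 0 := by positivity
    have h3 : (2 * (M + 2) + 2 : ℝ) ≠ 0 := by positivity
    have h4 : (2 * M + 4 : ℝ) ≠ 0 := by positivity
    have h5 : (2 * M + 6 : ℝ) ≠ 0 := by positivity
    field_simp
    ring
  all_goals
    have := hc M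
    have := hc (M + 1)
    have := hc (M + 2)
    exact Continuous.intervalIntegrable (by fun_prop) _ _

/-- Testing against the bump averages neighbouring orders with binomial weights, so it does not
exceed a uniform bound for the Bessel functions. -/
theorem norm_integral_bump_le {x S : ℝ} (hS : ∀ k : ℤ, |besselJ k x| ≤ S) (M : ℕ) (k : ℤ) :
    ‖∫ θ in (-Real.pi)..Real.pi, (((Real.cos (θ / 2) ^ 2) ^ M : ℝ) : ℂ) * besselIntegrand k x θ‖ ≤
      2 * Real.pi * S := by
  induction M generalizing k with
  | zero =>
    have h := hS k
    rw [abs_besselJ_eq, one_div_mul_eq_div, div_le_iff₀ Real.two_pi_pos] at h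
    simp only [pow_zero, Complex.ofReal_one, one_mul]
    linarith
  | succ M ih =>
    set F : ℤ → ℝ → ℂ := fun k θ => (((Real.cos (θ / 2) ^ 2) ^ M : ℝ) : ℂ) * besselIntegrand k x θ
      with hF
    have hc : ∀ k, Continuous (F k) := by
      intro k
      have := continuous_besselIntegrand k x
      simp only [hF]
      fun_prop
    have h : ∀ θ, (((Real.cos (θ / 2) ^ 2) ^ (M + 1) : ℝ) : ℂ) * besselIntegrand k x θ =
        (1 / 4) * F (k - 1) θ + (1 / 2) * F k θ + (1 / 4) * F (k + 1) θ := by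
      intro θ
      have e1 : besselIntegrand (k - 1) x θ =
          Complex.exp (θ * Complex.I) * besselIntegrand k x θ := by
        unfold besselIntegrand
        rw [← Complex.exp_add]
        congr 1
        push_cast
        ring
      have e2 : besselIntegrand (k + 1) x θ =
          Complex.exp (-θ * Complex.I) * besselIntegrand k x θ := by
        unfold besselIntegrand
        rw [← Complex.exp_add]
        congr 1
        push_cast
        ring
      have e3 : ((Real.cos (θ / 2) ^ 2 : ℝ) : ℂ) =
          1 / 2 + (Complex.exp (θ * Complex.I) + Complex.exp (-θ * Complex.I)) / 4 := by
        rw [Real.cos_sq, mul_div_cancel₀ _ two_ne_zero]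
        push_cast
        rw [Complex.cos]
        ring
      simp only [hF]
      rw [pow_succ, Complex.ofReal_mul, e3, e1, e2]
      ring
    simp only [h]
    rw [intervalIntegral.integral_add, intervalIntegral.integral_add,
      intervalIntegral.integral_const_mul, intervalIntegral.integral_const_mul,
      intervalIntegral.integral_const_mul]
    · refine (norm_add_le _ _).trans ((add_le_add_left (norm_add_le _ _) _).trans ?_)
      rw [norm_mul, norm_mul, norm_mul]
      have h1 : ‖∫ θ in (-Real.pi)..Real.pi, F (k - 1) θ‖ ≤ 2 * Real.pi * S := ih (k - 1)
      have h2 : ‖∫ θ in (-Real.pi)..Real.pi, F k θ‖ ≤ 2 * Real.pi * S := ih k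
      have h3 : ‖∫ θ in (-Real.pi)..Real.pi, F (k + 1) θ‖ ≤ 2 * Real.pi * S := ih (k + 1)
      rw [show ‖(1 / 4 : ℂ)‖ = 1 / 4 by norm_num, show ‖(1 / 2 : ℂ)‖ = 1 / 2 by norm_num]
      linarith
    all_goals
      have := hc (k - 1)
      have := hc k
      have := hc (k + 1)
      exact Continuous.intervalIntegrable (by fun_prop) _ _

/-- At order `k ≈ x` the phase is at most `|θ| + x |θ|³ / 6`: its linear part nearly
cancels. -/
theorem cos_phase_ge {x : ℝ} {k : ℤ} (hx : 0 ≤ x) (hk : |x - k| ≤ 1) {θ : ℝ}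
    (hθ : |θ| ≤ Real.pi) :
    1 - 10 * Real.sin (θ / 2) ^ 2 - 28 * x ^ 2 * (Real.sin (θ / 2) ^ 2) ^ 3 ≤
      Real.cos (x * Real.sin θ - k * θ) := by
  refine le_trans ?_ (Real.one_sub_sq_div_two_le_cos)
  set σ := Real.sin (θ / 2) ^ 2 with hσ
  have hσ0 : 0 ≤ σ := sq_nonneg _
  have hθσ : θ ^ 2 ≤ 9.93 * σ := by
    have h1 := Real.mul_le_sin (x := |θ| / 2) (by positivity) (by linarith)
    have h2 : Real.sin (|θ| / 2) ^ 2 = σ := by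
      obtain h | h := abs_choice θ
      · rw [h]
      · rw [h, neg_div, Real.sin_neg, neg_sq]
    have h3 : |θ| ≤ Real.pi * Real.sin (|θ| / 2) := by
      have e : 2 / Real.pi * (|θ| / 2) = |θ| / Real.pi := by ring
      rw [e, div_le_iff₀ Real.pi_pos] at h1
      linarith
    have h4 := pow_le_pow_left₀ (abs_nonneg θ) h3 2
    rw [sq_abs, mul_pow, h2] at h4
    have h5 : Real.pi ^ 2 ≤ 9.93 := by nlinarith [Real.pi_lt_d2, Real.pi_pos]
    nlinarith
  have hφ : |x * Real.sin θ - k * θ| ≤ |θ| + x * (|θ| ^ 3 / 6) := by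
    have e : x * Real.sin θ - k * θ = (x - k) * θ - x * (θ - Real.sin θ) := by ring
    rw [e]
    refine (abs_sub _ _).trans (add_le_add ?_ ?_)
    · rw [abs_mul]
      exact mul_le_of_le_one_left (abs_nonneg _) hk
    · rw [abs_mul, abs_of_nonneg hx]
      gcongr
      exact Real.abs_sub_sin_le θ
  have hφ2 : (x * Real.sin θ - k * θ) ^ 2 ≤ 2 * θ ^ 2 + x ^ 2 * (θ ^ 2) ^ 3 / 18 := by
    have h1 := pow_le_pow_left₀ (abs_nonneg _) hφ 2
    rw [sq_abs] at h1
    have h2 := sq_nonneg (|θ| - x * (|θ| ^ 3 / 6))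
    have h3 : (|θ| + x * (|θ| ^ 3 / 6)) ^ 2 + (|θ| - x * (|θ| ^ 3 / 6)) ^ 2 =
        2 * |θ| ^ 2 + x ^ 2 * (|θ| ^ 2) ^ 3 / 18 := by ring
    rw [sq_abs] at h3
    linarith
  have h6 : (θ ^ 2) ^ 3 ≤ 1008 * σ ^ 3 := by
    refine (pow_le_pow_left₀ (sq_nonneg θ) hθσ 3).trans ?_
    rw [mul_pow]
    gcongr
    norm_num
  have h7 : x ^ 2 * (θ ^ 2) ^ 3 ≤ x ^ 2 * (1008 * σ ^ 3) := by gcongr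
  linarith

/-- The decay rate `t ^ (-1/3)` is attained near the order `k ≈ 2t`: the average of `J_l(2t)` over a
window of about `t ^ (1/3)` orders around `2t` has that size. -/
theorem exists_besselJ_ge {t : ℝ} (ht : 1 ≤ t) :
    ∃ k : ℤ, 1 / 30 / t ^ ((1 : ℝ) / 3) ≤ |besselJ k (2 * t)| := by
  set r := t ^ ((1 : ℝ) / 3) with hr
  have hr1 : 1 ≤ r := Real.one_le_rpow ht (by norm_num)
  have hr3 : r ^ 3 = t := by
    rw [hr, ← Real.rpow_natCast, ← Real.rpow_mul (by linarith)]
    norm_num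
  by_contra! hlt
  set x := 2 * t with hx
  set M := ⌈40 * r ^ 2⌉₊ with hM
  have hMge : 40 * r ^ 2 ≤ M := Nat.le_ceil _
  have hMlt : (M : ℝ) < 40 * r ^ 2 + 1 := Nat.ceil_lt_add_one (by positivity)
  have hr2 : 1 ≤ r ^ 2 := one_le_pow₀ hr1
  have hM1 : 1 ≤ M := by
    have : (1 : ℝ) ≤ M := by linarith
    exact_mod_cast this
  set k : ℤ := ⌊x⌋ with hk
  have hkx : |x - k| ≤ 1 := by
    rw [abs_of_nonneg (sub_nonneg.2 (Int.floor_le x))]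
    linarith [Int.lt_floor_add_one x]
  have hup := norm_integral_bump_le (x := x) (S := 1 / 30 / r) (fun k => (hlt k).le) M k
  have hπ := Real.pi_pos
  have hA := bumpMass_pos M
  -- The real part of the tested integral is at least half the mass of the bump.
  have hlow : bumpMass M / 2 ≤ ‖∫ θ in (-Real.pi)..Real.pi,
      (((Real.cos (θ / 2) ^ 2) ^ M : ℝ) : ℂ) * besselIntegrand k x θ‖ := by
    refine le_trans ?_ (Complex.re_le_norm _)
    have hcont := continuous_besselIntegrand k x
    have hre := Complex.reCLM.intervalIntegral_comp_comm
      (Continuous.intervalIntegrable (μ := MeasureTheory.volume) (u := fun θ : ℝ =>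
        (((Real.cos (θ / 2) ^ 2) ^ M : ℝ) : ℂ) * besselIntegrand k x θ) (by fun_prop)
        (-Real.pi) Real.pi)
    rw [← Complex.reCLM_apply, ← hre]
    have hpt : ∀ θ : ℝ, Complex.reCLM ((((Real.cos (θ / 2) ^ 2) ^ M : ℝ) : ℂ) *
        besselIntegrand k x θ) =
        (Real.cos (θ / 2) ^ 2) ^ M * Real.cos (x * Real.sin θ - k * θ) := by
      intro θ
      rw [Complex.reCLM_apply, Complex.re_ofReal_mul, besselIntegrand, mul_comm Complex.I,
        Complex.exp_ofReal_mul_I_re]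
    simp only [hpt]
    have hmono : ∫ θ in (-Real.pi)..Real.pi, ((Real.cos (θ / 2) ^ 2) ^ M -
        10 * ((Real.cos (θ / 2) ^ 2) ^ M * Real.sin (θ / 2) ^ 2) -
        28 * x ^ 2 * ((Real.cos (θ / 2) ^ 2) ^ M * (Real.sin (θ / 2) ^ 2) ^ 3)) ≤
        ∫ θ in (-Real.pi)..Real.pi,
          (Real.cos (θ / 2) ^ 2) ^ M * Real.cos (x * Real.sin θ - k * θ) := by
      refine intervalIntegral.integral_mono_on (by linarith)
        (Continuous.intervalIntegrable (by fun_prop) _ _)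
        (Continuous.intervalIntegrable (by fun_prop) _ _) fun θ hθ => ?_
      have h1 := cos_phase_ge (x := x) (by linarith) hkx (abs_le.2 hθ)
      have h2 : 0 ≤ (Real.cos (θ / 2) ^ 2) ^ M := by positivity
      linarith [mul_le_mul_of_nonneg_left h1 h2]
    refine le_trans ?_ hmono
    rw [intervalIntegral.integral_sub, intervalIntegral.integral_sub,
      intervalIntegral.integral_const_mul, intervalIntegral.integral_const_mul, ← bumpMass,
      integral_bump_mul_sin, integral_bump_mul_sin_pow_six]
    · have h1 : 10 * (bumpMass M / (2 * M + 2)) ≤ bumpMass M / 4 := by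
        rw [mul_div_assoc', div_le_div_iff₀ (by positivity) (by norm_num)]
        nlinarith
      have h2 : 28 * x ^ 2 * (15 * bumpMass M / ((2 * M + 2) * (2 * M + 4) * (2 * M + 6))) ≤
          bumpMass M / 4 := by
        have hcube : (40 * r ^ 2) ^ 3 ≤ (M : ℝ) ^ 3 := pow_le_pow_left₀ (by positivity) hMge 3
        have hx2 : x ^ 2 = 4 * (r ^ 2) ^ 3 := by rw [hx, ← hr3]; ring
        have hM3 : 8 * (M : ℝ) ^ 3 ≤ (2 * M + 2) * (2 * M + 4) * (2 * M + 6) := by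
          have : (0 : ℝ) ≤ M := by positivity
          nlinarith [pow_nonneg this 2]
        rw [mul_div_assoc', div_le_div_iff₀ (by positivity) (by norm_num)]
        have : 28 * x ^ 2 * 15 * 4 ≤ (2 * M + 2) * (2 * M + 4) * (2 * M + 6 : ℝ) := by
          rw [hx2]
          rw [mul_pow] at hcube
          have h0 : 0 ≤ (r ^ 2) ^ 3 := by positivity
          linarith
        nlinarith
      linarith
    all_goals exact Continuous.intervalIntegrable (by fun_prop) _ _
  have hWallis := pi_sq_le_mul_bumpMass_sq hM1
  have h7 : Real.pi ≤ 7 * r * bumpMass M := by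
    refine le_of_sq_le_sq (hWallis.trans ?_) (by positivity)
    rw [mul_pow]
    gcongr
    nlinarith
  have h8 := hlow.trans hup
  have h9 : bumpMass M * r ≤ 4 * Real.pi * (1 / 30) := by
    have e : 2 * Real.pi * (1 / 30 / r) = 2 * Real.pi * (1 / 30) / r := by ring
    rw [e, div_le_div_iff₀ two_pos (by linarith)] at h8
    linarith
  nlinarith

/-! ### The finite propagator is unitary -/

section FiniteGraph

variable {V : Type*} [Fintype V] [DecidableEq V] (G : SimpleGraph V) [DecidableRel G.Adj]
  (Q : V → ℝ) (t : ℝ)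

theorem finiteHamiltonian_conjTranspose :
    (finiteHamiltonian G Q).conjTranspose = finiteHamiltonian G Q := by
  ext i j
  simp only [finiteHamiltonian, Matrix.conjTranspose_apply, Matrix.add_apply,
    SimpleGraph.adjMatrix_apply, Matrix.diagonal_apply, star_add, G.adj_comm j i]
  congr 1
  · split_ifs <;> simp
  · by_cases h : i = j
    · subst h; simp
    · simp [h, Ne.symm h]

theorem sum_norm_sq_exp_finiteHamiltonian (q : V) :
    ∑ p, ‖NormedSpace.exp ((Complex.I * (t : ℂ)) • finiteHamiltonian G Q) p q‖ ^ 2 = 1 := by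
  set A := (Complex.I * (t : ℂ)) • finiteHamiltonian G Q with hA
  have hstar : A.conjTranspose = -A := by
    rw [hA, Matrix.conjTranspose_smul, finiteHamiltonian_conjTranspose, ← neg_smul]
    simp
  have hone : (NormedSpace.exp A).conjTranspose * NormedSpace.exp A = 1 := by
    rw [← Matrix.exp_conjTranspose, hstar,
      ← Matrix.exp_add_of_commute _ _ (Commute.neg_left (Commute.refl A)), neg_add_cancel,
      NormedSpace.exp_zero]
  have h := congrFun (congrFun hone q) q
  rw [Matrix.mul_apply, Matrix.one_apply_eq] at h
  have h2 : ((∑ p, ‖NormedSpace.exp A p q‖ ^ 2 : ℝ) : ℂ) = 1 := by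
    rw [← h]
    push_cast
    refine Finset.sum_congr rfl fun p _ => ?_
    rw [Matrix.conjTranspose_apply, Complex.star_def, Complex.conj_mul']
  exact_mod_cast h2

theorem norm_exp_finiteHamiltonian_le_one (p q : V) :
    ‖NormedSpace.exp ((Complex.I * (t : ℂ)) • finiteHamiltonian G Q) p q‖ ≤ 1 := by
  have h := Finset.single_le_sum (f := fun p => ‖NormedSpace.exp ((Complex.I * (t : ℂ)) •
    finiteHamiltonian G Q) p q‖ ^ 2) (fun _ _ => sq_nonneg _) (Finset.mem_univ p)
  rw [sum_norm_sq_exp_finiteHamiltonian] at h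
  exact (sq_le_one_iff₀ (norm_nonneg _)).1 h

theorem exists_norm_exp_finiteHamiltonian_ge (q : V) :
    ∃ p, 1 / (Fintype.card V : ℝ) ≤
      ‖NormedSpace.exp ((Complex.I * (t : ℂ)) • finiteHamiltonian G Q) p q‖ := by
  by_contra! hlt
  have : Nonempty V := ⟨q⟩
  have hsum := sum_norm_sq_exp_finiteHamiltonian G Q t q
  have hN : (1 : ℝ) ≤ Fintype.card V := by exact_mod_cast Fintype.card_pos
  have : ∑ p, ‖NormedSpace.exp ((Complex.I * (t : ℂ)) • finiteHamiltonian G Q) p q‖ ^ 2 <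
      ∑ _p : V, 1 / (Fintype.card V : ℝ) := by
    refine Finset.sum_lt_sum_of_nonempty Finset.univ_nonempty fun p _ => ?_
    have h1 := hlt p
    have h2 : 1 / (Fintype.card V : ℝ) ≤ 1 := by
      rw [div_le_one (by linarith)]
      exact hN
    nlinarith [norm_nonneg (NormedSpace.exp ((Complex.I * (t : ℂ)) • finiteHamiltonian G Q) p q)]
  rw [hsum, Finset.sum_const, Finset.card_univ, nsmul_eq_mul,
    mul_one_div_cancel (by linarith)] at this
  exact lt_irrefl _ this

end FiniteGraph

/-! ### From kernel bounds to `ℓ¹ → ℓ^∞` bounds -/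

theorem norm_l2ToLinfty_apply_le {X : Type*} [DecidableEq X]
    (T : lp (fun _ : X => ℂ) 2 →L[ℂ] lp (fun _ : X => ℂ) 2) {K : ℝ} (hK0 : 0 ≤ K)
    (hK : ∀ x y, ‖kernel T x y‖ ≤ K) (f : lp (fun _ : X => ℂ) 1) :
    ‖l2ToLinfty (T (l1ToL2 f))‖ ≤ K * ‖f‖ := by
  refine lp.norm_le_of_forall_le (mul_nonneg hK0 (norm_nonneg _)) fun x => ?_
  have h1 := ((lp.hasSum_single (by norm_num) (l1ToL2 f)).mapL T).mapL
    (lp.evalCLM ℂ (fun _ : X => ℂ) 2 x)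
  have h2 : HasSum (fun y => K * ‖f y‖) (K * ‖f‖) := by
    have := lp.hasSum_norm (p := 1) (by norm_num) f
    simp only [ENNReal.toReal_one, Real.rpow_one] at this
    exact this.mul_left K
  refine h1.norm_le_of_bounded h2 fun y => ?_
  have h3 : lp.single 2 y (l1ToL2 f y) = f y • (lp.single 2 y (1 : ℂ) : lp (fun _ : X => ℂ) 2) := by
    rw [← lp.single_smul, smul_eq_mul, mul_one]
    rfl
  rw [h3, map_smul, map_smul, norm_smul, mul_comm]
  exact mul_le_mul_of_nonneg_right (hK x y) (norm_nonneg _)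

theorem norm_kernel_le_norm_l2ToLinfty {X : Type*} [DecidableEq X]
    (T : lp (fun _ : X => ℂ) 2 →L[ℂ] lp (fun _ : X => ℂ) 2) (x y : X) :
    ‖kernel T x y‖ ≤ ‖l2ToLinfty (T (l1ToL2 (lp.single 1 y (1 : ℂ))))‖ := by
  have h : l1ToL2 (lp.single 1 y (1 : ℂ)) = lp.single 2 y (1 : ℂ) := rfl
  rw [h]
  exact lp.norm_apply_le_norm ENNReal.top_ne_zero (l2ToLinfty (T (lp.single 2 y (1 : ℂ)))) x

theorem norm_bessel_prod {d : ℕ} (k : Fin d → ℤ) (t : ℝ) :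
    ‖∏ j, Complex.I ^ k j * (besselJ (k j) t : ℂ)‖ = ∏ j, |besselJ (k j) t| := by
  rw [norm_prod]
  refine Finset.prod_congr rfl fun j _ => ?_
  rw [norm_mul, norm_zpow, Complex.norm_I, one_zpow, one_mul, Complex.norm_real, Real.norm_eq_abs]

theorem rpow_div_three {t : ℝ} (ht : 0 ≤ t) (d : ℕ) :
    t ^ ((d : ℝ) / 3) = (t ^ ((1 : ℝ) / 3)) ^ d := by
  rw [← Real.rpow_natCast, ← Real.rpow_mul ht]
  congr 1
  ring

end

theorem theorem1 {V : Type*} [Fintype V] [DecidableEq V] [Nonempty V]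
    (d : ℕ) (hd : 1 ≤ d) (G : SimpleGraph V) [DecidableRel G.Adj] (Q : V → ℝ) :
    (∀ (t : ℝ) (n m : Fin d → ℤ) (p q : V),
      kernel (propagator (productHamiltonian d G Q) t) (n, p) (m, q) =
        (∏ j : Fin d, Complex.I ^ (n j - m j) * (besselJ (n j - m j) (2 * t) : ℂ)) *
          (NormedSpace.exp ((Complex.I * (t : ℂ)) • finiteHamiltonian G Q)) p q) ∧
    (∀ t : ℝ, 0 < t → ∀ f : lp (fun _ : (Fin d → ℤ) × V => ℂ) 1, f ≠ 0 →
      ‖l2ToLinfty (propagator (productHamiltonian d G Q) t (l1ToL2 f))‖ <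
        1 / t ^ ((d : ℝ) / 3) * ‖f‖) ∧
    (∃ c : ℝ, 0 < c ∧ ∀ t : ℝ, 1 ≤ t → ∃ f : lp (fun _ : (Fin d → ℤ) × V => ℂ) 1, f ≠ 0 ∧
      c / t ^ ((d : ℝ) / 3) * ‖f‖ ≤
        ‖l2ToLinfty (propagator (productHamiltonian d G Q) t (l1ToL2 f))‖) := by
  refine ⟨kernel_propagator_productHamiltonian G Q, fun t ht f hf => ?_, ?_⟩
  · obtain ⟨C, hC0, hC, hJ⟩ := exists_besselJ_bound ht
    have hK : ∀ x y, ‖kernel (propagator (productHamiltonian d G Q) t) x y‖ ≤ C ^ d := by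
      rintro ⟨n, p⟩ ⟨m, q⟩
      rw [kernel_propagator_productHamiltonian, norm_mul,
        norm_bessel_prod (fun j => n j - m j)]
      refine (mul_le_of_le_one_right (Finset.prod_nonneg fun _ _ => abs_nonneg _)
        (norm_exp_finiteHamiltonian_le_one G Q t p q)).trans ?_
      refine (Finset.prod_le_prod (fun _ _ => abs_nonneg _) fun j _ => hJ (n j - m j)).trans ?_
      simp
    refine (norm_l2ToLinfty_apply_le _ (by positivity) hK f).trans_lt ?_
    refine mul_lt_mul_of_pos_right ?_ (norm_pos_iff.2 hf)
    rw [rpow_div_three ht.le, ← one_div_pow]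
    exact pow_lt_pow_left₀ hC hC0 (by omega)
  · have hN : (0 : ℝ) < Fintype.card V := by exact_mod_cast Fintype.card_pos
    refine ⟨(1 / 30) ^ d * (1 / Fintype.card V), by positivity, fun t ht => ?_⟩
    obtain ⟨k, hk⟩ := exists_besselJ_ge ht
    obtain ⟨q⟩ := ‹Nonempty V›
    obtain ⟨p, hp⟩ := exists_norm_exp_finiteHamiltonian_ge G Q t q
    have hnorm : ‖(lp.single 1 ((0 : Fin d → ℤ), q) (1 : ℂ) :
        lp (fun _ : (Fin d → ℤ) × V => ℂ) 1)‖ = 1 := by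
      rw [lp.norm_single (by norm_num), norm_one]
    refine ⟨lp.single 1 ((0 : Fin d → ℤ), q) (1 : ℂ), fun h => ?_, ?_⟩
    · rw [h, norm_zero] at hnorm
      exact zero_ne_one hnorm
    · refine le_trans ?_ (norm_kernel_le_norm_l2ToLinfty
        (propagator (productHamiltonian d G Q) t) ((fun _ : Fin d => k), p)
        ((0 : Fin d → ℤ), q))
      rw [kernel_propagator_productHamiltonian, norm_mul, hnorm, mul_one,
        rpow_div_three (by linarith)]
      simp only [Pi.zero_apply, sub_zero]
      rw [norm_bessel_prod (fun _ : Fin d => k)]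
      simp only [Finset.prod_const, Finset.card_univ, Fintype.card_fin]
      have ht0 : 0 < t ^ ((1 : ℝ) / 3) := Real.rpow_pos_of_pos (by linarith) _
      rw [mul_div_right_comm, ← div_pow]
      gcongr
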